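/- Let $\delta_{i,j}$ ($1\le i\le 3$, $1\le j\le 4$) be integers with $\delta_{i,j}\ge 1$ for $j\le 3$ and $\delta_{i,4}\ge 0$, let $\gamma\ge 1$ be an integer, and assume $$\frac{\delta_{1,1}}{\delta_{1,1}+\min\{\delta_{2,1},\delta_{3,1}\}}+\frac{\delta_{2,2}}{\delta_{2,2}+\min\{\delta_{1,2},\delta_{3,2}\}}+\frac{\delta_{3,3}}{\delta_{3,3}+\min\{\delta_{1,3},\delta_{2,3}\}}<1 .$$ In the rational function field $\mathbb{R}(x_1,x_2,x_3,x_4)$ put $$y_1=x_1^{-\delta_{1,1}}x_2^{\delta_{1,2}}x_3^{\delta_{1,3}}x_4^{\delta_{1,4}},\quad y_2=x_1^{\delta_{2,1}}x_2^{-\delta_{2,2}}x_3^{\delta_{2,3}}x_4^{\delta_{2,4}},\quad y_3=x_1^{\delta_{3,1}}x_2^{\delta_{3,2}}x_3^{-\delta_{3,3}}x_4^{\delta_{3,4}},\quad y_4=x_4^{\gamma},$$ and $\Pi_i=y_i-y_4$ for $i=1,2,3$. Let $R=\mathbb{R}[x_1,\dots,x_4]\cap\mathbb{R}(\Pi_1,\Pi_2,\Pi_3)$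 (a member of Kuroda's family of counterexamples to Hilbert's 14th problem) and $T=\mathbb{R}[y_1,\dots,y_4]\cap\mathbb{R}[x_1,\dots,x_4]$. Let $$S'=\bigl\{(b_1,\dots,b_4)\in\mathbb{R}^4 : |b_i^{\delta_{j,i}}b_j^{\delta_{i,i}}|<1\ \text{for all } i\ne j \text{ in } \{1,2,3\},\ |b_4|<1\bigr\},$$ let $f:\mathbb{R}^4\to\mathbb{R}^3$, $f(b)=(b_1-b_4,\,b_2-b_4,\,b_3-b_4)$, be the projection along the diagonal, and let $S=f(S')$. For a subset $A\subseteq\mathbb{R}^n$ let $B_{\mathbb{R}^n}(A)$ be the ring of real polynomials in $n$ variables that are bounded on $A$. Then: (0) $y_1,\dots,y_4$ are algebraically independent over $\mathbb{R}$, and so are $\Pi_1,\Pi_2,\Pi_3$; accordingly $\mathbb{R}[y_1,\dots,y_4]$ and $\mathbb{R}[\Pi_1,\Pi_2,\Pi_3]$ are regarded as the coordinate rings of $\mathbb{R}^4$ and $\mathbb{R}^3$. (i) $T$ is generated as an $\mathbb{R}$-algebra by the set of all monomials $y_1^{n_1}y_2^{n_2}y_3^{n_3}y_4^{n_4}$ with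 integers $n_1,\dots,n_4\ge 0$ such that $\delta_{i,i}n_i\le\delta_{j,i}n_j+\delta_{k,i}n_k$ whenever $\{i,j,k\}=\{1,2,3\}$. (ii) $S'$ is an open semialgebraic subset of $\mathbb{R}^4$, and $B_{\mathbb{R}^4}(\lambda S')=T$, as subalgebras of $\mathbb{R}[y_1,\dots,y_4]$, for every real $\lambda>0$. (iii) $S$ is an open semialgebraic subset of $\mathbb{R}^3$, and $B_{\mathbb{R}^3}(\lambda S)=R$, as subalgebras of $\mathbb{R}[\Pi_1,\Pi_2,\Pi_3]$, for every real $\lambda>0$. In particular $B_{\mathbb{R}^3}(S)$ is not finitely generated as an $\mathbb{R}$-algebra. -/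

import Mathlib

open scoped Pointwise

namespace Kuroda

noncomputable section

/-! ### Semialgebraic sets and bounded polynomials on real affine space -/

/-- A subset of `ℝⁿ` is semialgebraic if it is a finite union of sets of the form
`{x | p₁ x > 0, …, p_r x > 0, g x = 0}` with real polynomials `p₁, …, p_r, g`. -/
def IsSemialgebraic {n : ℕ} (S : Set (Fin n → ℝ)) : Prop :=
  ∃ C : Set (Finset (MvPolynomial (Fin n) ℝ) × MvPolynomial (Fin n) ℝ), C.Finite ∧
    S = ⋃ c ∈ C, {x | (∀ p ∈ c.1, 0 < MvPolynomial.eval x p) ∧ MvPolynomial.eval x c.2 = 0}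

/-- The ring of those polynomials in `n` real variables which are bounded on `S ⊆ ℝⁿ`. -/
def boundedPolynomials {n : ℕ} (S : Set (Fin n → ℝ)) :
    Subalgebra ℝ (MvPolynomial (Fin n) ℝ) where
  carrier := {p | ∃ c : ℝ, ∀ x ∈ S, |MvPolynomial.eval x p| ≤ c}
  mul_mem' := by
    rintro p q ⟨c, hc⟩ ⟨d, hd⟩
    refine ⟨c * d, fun x hx => ?_⟩
    rw [map_mul, abs_mul]
    exact mul_le_mul (hc x hx) (hd x hx) (abs_nonneg _) ((abs_nonneg _).trans (hc x hx))
  add_mem' := by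
    rintro p q ⟨c, hc⟩ ⟨d, hd⟩
    refine ⟨c + d, fun x hx => ?_⟩
    rw [map_add]
    exact (abs_add_le _ _).trans (add_le_add (hc x hx) (hd x hx))
  algebraMap_mem' := by
    intro r
    refine ⟨|r|, fun x _ => ?_⟩
    simp [MvPolynomial.algebraMap_eq]

/-! ### Kuroda's algebras over `ℝ`

The parameters are `δ i j` (`i = 0, 1, 2`, `j = 0, 1, 2, 3`) and `γ`, natural numbers. -/

/-- The rational function field `ℝ(x₁, x₂, x₃, x₄)`. -/
abbrev RatFun : Type := FractionRing (MvPolynomial (Fin 4) ℝ)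

/-- The coordinate `x_j` as a rational function. -/
def x (j : Fin 4) : RatFun :=
  algebraMap (MvPolynomial (Fin 4) ℝ) RatFun (MvPolynomial.X j)

/-- The `i`-th exponent vector in `ℤ⁴`: its entries are `δ i j`, with a minus sign at `j = i`. -/
def expVec (δ : Fin 3 → Fin 4 → ℕ) (i : Fin 3) (j : Fin 4) : ℤ :=
  if j = i.castSucc then -(δ i j : ℤ) else (δ i j : ℤ)

/-- The elements `y₁, y₂, y₃` (Laurent monomials in the `x_j`) and `y₄ = x₄ ^ γ`. -/
def y (δ : Fin 3 → Fin 4 → ℕ) (γ : ℕ) : Fin 4 → RatFun :=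
  Fin.snoc (fun i : Fin 3 => ∏ j : Fin 4, x j ^ expVec δ i j) (x 3 ^ γ)

/-- The elements `Π_i = y_i - y₄`, `i = 1, 2, 3`. -/
def bigPi (δ : Fin 3 → Fin 4 → ℕ) (γ : ℕ) (i : Fin 3) : RatFun :=
  y δ γ i.castSucc - y δ γ 3

/-- The polynomial ring `ℝ[x₁, x₂, x₃, x₄]` inside its field of fractions. -/
def polyX : Subalgebra ℝ RatFun :=
  (IsScalarTower.toAlgHom ℝ (MvPolynomial (Fin 4) ℝ) RatFun).range

/-- Kuroda's algebra `R = ℝ[x] ∩ ℝ(Π₁, Π₂, Π₃)`. -/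
def algR (δ : Fin 3 → Fin 4 → ℕ) (γ : ℕ) : Subalgebra ℝ RatFun :=
  polyX ⊓ (IntermediateField.adjoin ℝ (Set.range (bigPi δ γ))).toSubalgebra

/-- The algebra `T = ℝ[y₁, y₂, y₃, y₄] ∩ ℝ[x]`. -/
def algT (δ : Fin 3 → Fin 4 → ℕ) (γ : ℕ) : Subalgebra ℝ RatFun :=
  Algebra.adjoin ℝ (Set.range (y δ γ)) ⊓ polyX

/-- The set `M` of all monomials `y ^ n`, `n ∈ ℕ⁴`, such that
`δ_{i,i} n_i ≤ δ_{j,i} n_j + δ_{k,i} n_k` whenever `{i, j, k} = {1, 2, 3}`. -/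
def monomialsM (δ : Fin 3 → Fin 4 → ℕ) (γ : ℕ) : Set RatFun :=
  {m | ∃ n : Fin 4 → ℕ,
    (∀ i j k : Fin 3, i ≠ j → i ≠ k → j ≠ k →
      δ i i.castSucc * n i.castSucc ≤
        δ j i.castSucc * n j.castSucc + δ k i.castSucc * n k.castSucc) ∧
    m = ∏ l : Fin 4, y δ γ l ^ n l}

/-- The star `S' ⊆ ℝ⁴`. -/
def starSet (δ : Fin 3 → Fin 4 → ℕ) : Set (Fin 4 → ℝ) :=
  {b | (∀ i j : Fin 3, i ≠ j →
      |b i.castSucc ^ δ j i.castSucc * b j.castSucc ^ δ i i.castSucc| < 1) ∧ |b 3| < 1}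

/-- The projection `ℝ⁴ → ℝ³` along the diagonal, `b ↦ (b₁ - b₄, b₂ - b₄, b₃ - b₄)`. -/
def diagProj (b : Fin 4 → ℝ) : Fin 3 → ℝ :=
  fun i => b i.castSucc - b 3

/-- The set `S = f(S') ⊆ ℝ³`, where `f` is the projection along the diagonal. -/
def projStar (δ : Fin 3 → Fin 4 → ℕ) : Set (Fin 3 → ℝ) :=
  diagProj '' starSet δ

end

end Kuroda

/-!
# Bounded polynomials on a star and Kuroda's algebra

*Laurent monomials.* The `y_l` are Laurent monomials in the `x_j`, and the numerical condition makes
the determinant of the exponents of `y₁, y₂, y₃` in `x₁, x₂, x₃` positive. Hence distinct monomials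
in the `y_l` are distinct, linearly independent Laurent monomials
(`yExp_injective`, `linearIndependent_laurent`), and a polynomial in the `y_l` is a polynomial in the
`x_j` if and only if all its exponents lie in `cone δ` (`aeval_y_mem_polyX_iff`). This gives the
algebraic independence statements and the generators of `T`.

*Bounded polynomials.* Monomials with exponents in the cone are bounded by `1` on the star
(`abs_monomial_le_one`). Conversely, the star contains an arm along each of the first three axes,
filled by curves `t ↦ c_l * t ^ (-expVec δ l i)`; a polynomial bounded along all of them has no part
of negative weight for that axis (`boundedPolynomials_starSet`). A polynomial on `ℝ³` is bounded on
the projection exactly when its composition with the projection (`diagHom`) is bounded on the star.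

*The field of fractions.* An element `P / Q` of `ℝ(Π)` lying in `ℝ[x]` is a Laurent polynomial in the
`y_l` (`mem_laurentSpan_range_yExp`), so `Q` divides the product of `P` and a monomial in the `y_l`.
As `Q` is invariant under diagonal translations, it is coprime to every `y_l`, so `Q` divides `P`
(`mem_range_aeval_bigPi`).

*Infinite generation.* A diagonally invariant polynomial with support in the cone has no term
`c * y₄ ^ m` with `m > 0` (`coeff_single_three_eq_zero`). Finitely many generators would therefore
bound the exponent of `y₄` by a fixed multiple of the degree in `y₁, y₂, y₃`. On the other hand,
there are such polynomials containing a product of `y₄ ^ K`, for any `K`, and a monomial of fixed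
degree in `y₁, y₂, y₃` (`exists_invariant`): they are coefficients of the power series
`exp ((y₂ - y₄) z) * ∑ h_k z ^ k` with binary forms `h_k` in the differences of the `y_i`, and the
support condition amounts to prescribed orders of vanishing of these forms along three lines, which
can be realized by Hermite interpolation because the three fractions add up to less than one.

*Semialgebraicity.* The projection of the star is defined by strict polynomial inequalities with one
quantified variable in `(-1, 1)`. This variable is eliminated by showing that the sign diagram of a
finite family of univariate polynomials, closed under derivatives, truncations and
pseudo-remainders, depends only on the signs of finitely many polynomials in the parameters
(`exists_finite_signs_determine`).
-/

namespace Kuroda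

/-! ### Elimination of one real variable -/

section Elimination

open Polynomial Set

/-- A strictly increasing polynomial that is negative at one end of an interval and positive at
the other changes sign exactly once. -/
theorem exists_root_of_strictMonoOn {p : ℝ[X]} {a b : ℝ} (hab : a < b)
    (hp : StrictMonoOn (fun t => p.eval t) (Icc a b)) (ha : p.eval a < 0) (hb : 0 < p.eval b) :
    ∃ c ∈ Ioo a b, p.eval c = 0 ∧ (∀ t ∈ Ioo a c, SignType.sign (p.eval t) = -1) ∧
      ∀ t ∈ Ioo c b, SignType.sign (p.eval t) = 1 := by
  obtain ⟨c, hc, hc0⟩ := intermediate_value_Ioo hab.le (p.continuous.continuousOn) ⟨ha, hb⟩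
  have hc0' : p.eval c = 0 := hc0
  refine ⟨c, hc, hc0', fun t ht => sign_neg ?_, fun t ht => sign_pos ?_⟩
  · exact hc0' ▸ hp ⟨ht.1.le, ht.2.le.trans hc.2.le⟩ ⟨hc.1.le, hc.2.le⟩ ht.2
  · exact hc0' ▸ hp ⟨hc.1.le, hc.2.le⟩ ⟨hc.1.le.trans ht.1.le, ht.2.le⟩ ht.1

theorem strictMonoOn_eval_of_derivative_pos {p : ℝ[X]} {a b : ℝ}
    (hp : ∀ t ∈ Ioo a b, SignType.sign (p.derivative.eval t) = 1) :
    StrictMonoOn (fun t => p.eval t) (Icc a b) := by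
  refine strictMonoOn_of_deriv_pos (convex_Icc a b) p.continuous.continuousOn fun t ht => ?_
  rw [interior_Icc] at ht
  rw [p.deriv]
  exact sign_eq_one_iff.1 (hp t ht)

/-- The sign diagrams of `p` on `(a, b)` and of `q` on `(a', b')` agree and are as simple as those
of monotone polynomials: either both polynomials have the same constant sign, or both intervals are
cut by one root into two pieces on which the signs are constant and equal. -/
def SameDiagram (p q : ℝ[X]) (a b a' b' : ℝ) : Prop :=
  (∃ τ, (∀ t ∈ Ioo a b, SignType.sign (p.eval t) = τ) ∧
      ∀ t ∈ Ioo a' b', SignType.sign (q.eval t) = τ) ∨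
    ∃ c ∈ Ioo a b, ∃ c' ∈ Ioo a' b', p.eval c = 0 ∧ q.eval c' = 0 ∧
      (∃ τ, (∀ t ∈ Ioo a c, SignType.sign (p.eval t) = τ) ∧
        ∀ t ∈ Ioo a' c', SignType.sign (q.eval t) = τ) ∧
      ∃ τ, (∀ t ∈ Ioo c b, SignType.sign (p.eval t) = τ) ∧
        ∀ t ∈ Ioo c' b', SignType.sign (q.eval t) = τ

theorem sameDiagram_of_derivative_pos {p q : ℝ[X]} {a b a' b' : ℝ} (hab : a < b) (hab' : a' < b')
    (hp : ∀ t ∈ Ioo a b, SignType.sign (p.derivative.eval t) = 1)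
    (hq : ∀ t ∈ Ioo a' b', SignType.sign (q.derivative.eval t) = 1)
    (ha : SignType.sign (p.eval a) = SignType.sign (q.eval a'))
    (hb : SignType.sign (p.eval b) = SignType.sign (q.eval b')) :
    SameDiagram p q a b a' b' := by
  have mp := strictMonoOn_eval_of_derivative_pos hp
  have mq := strictMonoOn_eval_of_derivative_pos hq
  have pos : ∀ {p : ℝ[X]} {a b : ℝ}, StrictMonoOn (fun t => p.eval t) (Icc a b) →
      0 ≤ p.eval a → ∀ t ∈ Ioo a b, SignType.sign (p.eval t) = 1 := by
    intro p a b m h t ht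
    exact sign_pos (h.trans_lt (m ⟨le_rfl, (ht.1.trans ht.2).le⟩ ⟨ht.1.le, ht.2.le⟩ ht.1))
  have neg : ∀ {p : ℝ[X]} {a b : ℝ}, StrictMonoOn (fun t => p.eval t) (Icc a b) →
      p.eval b ≤ 0 → ∀ t ∈ Ioo a b, SignType.sign (p.eval t) = -1 := by
    intro p a b m h t ht
    exact sign_neg ((m ⟨ht.1.le, ht.2.le⟩ ⟨(ht.1.trans ht.2).le, le_rfl⟩ ht.2).trans_le h)
  rcases le_or_gt 0 (p.eval a) with h | h
  · have h' : 0 ≤ q.eval a' := by rwa [← sign_nonneg_iff, ← ha, sign_nonneg_iff]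
    exact Or.inl ⟨1, pos mp h, pos mq h'⟩
  rcases le_or_gt (p.eval b) 0 with k | k
  · have k' : q.eval b' ≤ 0 := by rwa [← sign_nonpos_iff, ← hb, sign_nonpos_iff]
    exact Or.inl ⟨-1, neg mp k, neg mq k'⟩
  have h' : q.eval a' < 0 := by rwa [← sign_eq_neg_one_iff, ← ha, sign_eq_neg_one_iff]
  have k' : 0 < q.eval b' := by rwa [← sign_eq_one_iff, ← hb, sign_eq_one_iff]
  obtain ⟨c, hc, c0, c1, c2⟩ := exists_root_of_strictMonoOn hab mp h k
  obtain ⟨d, hd, d0, d1, d2⟩ := exists_root_of_strictMonoOn hab' mq h' k'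
  exact Or.inr ⟨c, hc, d, hd, c0, d0, ⟨-1, c1, d1⟩, ⟨1, c2, d2⟩⟩

theorem SameDiagram.of_neg {p q : ℝ[X]} {a b a' b' : ℝ}
    (h : SameDiagram (-p) (-q) a b a' b') : SameDiagram p q a b a' b' := by
  have key : ∀ {r : ℝ[X]} {t : ℝ} {τ : SignType},
      SignType.sign ((-r).eval t) = τ → SignType.sign (r.eval t) = -τ := by
    intro r t τ h
    rw [← h, eval_neg, Left.sign_neg, neg_neg]
  rcases h with ⟨τ, h1, h2⟩ | ⟨c, hc, d, hd, c0, d0, ⟨τ, h1, h2⟩, ⟨τ', h3, h4⟩⟩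
  · exact Or.inl ⟨-τ, fun t ht => key (h1 t ht), fun t ht => key (h2 t ht)⟩
  · refine Or.inr ⟨c, hc, d, hd, by simpa using c0, by simpa using d0,
      ⟨-τ, fun t ht => key (h1 t ht), fun t ht => key (h2 t ht)⟩,
      ⟨-τ', fun t ht => key (h3 t ht), fun t ht => key (h4 t ht)⟩⟩

theorem eq_C_of_sign_derivative_eq_zero {p : ℝ[X]} {a b : ℝ} (hab : a < b)
    (hp : ∀ t ∈ Ioo a b, SignType.sign (p.derivative.eval t) = 0) :
    p = C (p.coeff 0) := by
  apply eq_C_of_derivative_eq_zero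
  refine eq_zero_of_infinite_isRoot _ ((Ioo_infinite hab).mono fun t ht => ?_)
  exact sign_eq_zero_iff.1 (hp t ht)

/-- Two polynomials whose derivatives have the same constant sign inside have the same sign diagram
as soon as their signs agree at the end points. -/
theorem sameDiagram_of_derivative {p q : ℝ[X]} {a b a' b' : ℝ} (hab : a < b) (hab' : a' < b')
    (h : ∃ τ, (∀ t ∈ Ioo a b, SignType.sign (p.derivative.eval t) = τ) ∧
      ∀ t ∈ Ioo a' b', SignType.sign (q.derivative.eval t) = τ)
    (ha : SignType.sign (p.eval a) = SignType.sign (q.eval a'))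
    (hb : SignType.sign (p.eval b) = SignType.sign (q.eval b')) :
    SameDiagram p q a b a' b' := by
  obtain ⟨τ, hp, hq⟩ := h
  rcases τ with _ | _ | _
  · have hp' := eq_C_of_sign_derivative_eq_zero hab hp
    have hq' := eq_C_of_sign_derivative_eq_zero hab' hq
    refine Or.inl ⟨SignType.sign (p.eval a), fun t _ => ?_, fun t _ => ?_⟩
    · rw [hp', eval_C, eval_C]
    · rw [ha, hq', eval_C, eval_C]
  · apply SameDiagram.of_neg
    refine sameDiagram_of_derivative_pos hab hab' (fun t ht => ?_) (fun t ht => ?_) ?_ ?_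
    · rw [derivative_neg, eval_neg, Left.sign_neg, hp t ht]; rfl
    · rw [derivative_neg, eval_neg, Left.sign_neg, hq t ht]; rfl
    · rw [eval_neg, eval_neg, Left.sign_neg, Left.sign_neg, ha]
    · rw [eval_neg, eval_neg, Left.sign_neg, Left.sign_neg, hb]
  · exact sameDiagram_of_derivative_pos hab hab' hp hq ha hb

variable {R : Type*} [CommRing R]

/-- The sign at `t` of a polynomial whose coefficients are specialized through `φ`. -/
noncomputable def specSign (φ : R →+* ℝ) (g : R[X]) (t : ℝ) : SignType :=
  SignType.sign ((g.map φ).eval t)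

/-- A pair of corresponding break points of two specializations of the family `G`: the points
`-1` and `1`, and common roots of a member of `G` whose leading coefficient survives in both
specializations. -/
def Anchor (φ ψ : R →+* ℝ) (G : Set R[X]) (a a' : ℝ) : Prop :=
  (a = -1 ∧ a' = -1) ∨ (a = 1 ∧ a' = 1) ∨
    ∃ g ∈ G, φ g.leadingCoeff ≠ 0 ∧ ψ g.leadingCoeff ≠ 0 ∧
      (g.map φ).eval a = 0 ∧ (g.map ψ).eval a' = 0

theorem Anchor.mono {φ ψ : R →+* ℝ} {G H : Set R[X]} (hGH : G ⊆ H) {a a' : ℝ}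
    (h : Anchor φ ψ G a a') : Anchor φ ψ H a a' := by
  rcases h with h | h | ⟨g, hg, h⟩
  · exact Or.inl h
  · exact Or.inr (Or.inl h)
  · exact Or.inr (Or.inr ⟨g, hGH hg, h⟩)

/-- The family `G` has the same sign diagram over `[a, b]` in the specialization `φ` as over
`[a', b']` in the specialization `ψ`: both intervals are cut by the same number of corresponding
break points into pieces on which all members of `G` have constant and equal signs. -/
inductive Matched (φ ψ : R →+* ℝ) (G : Set R[X]) : ℝ → ℝ → ℝ → ℝ → Prop
  | base {a b a' b' : ℝ} (hab : a < b) (hab' : a' < b')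
      (ha : Anchor φ ψ G a a') (hb : Anchor φ ψ G b b')
      (sa : ∀ g ∈ G, specSign φ g a = specSign ψ g a')
      (sb : ∀ g ∈ G, specSign φ g b = specSign ψ g b')
      (hG : ∀ g ∈ G, ∃ τ, (∀ t ∈ Ioo a b, specSign φ g t = τ) ∧
        ∀ t ∈ Ioo a' b', specSign ψ g t = τ) : Matched φ ψ G a b a' b'
  | concat {a b c a' b' c' : ℝ} (h₁ : Matched φ ψ G a b a' b') (h₂ : Matched φ ψ G b c b' c') :
      Matched φ ψ G a c a' c'

theorem Matched.sign_right {φ ψ : R →+* ℝ} {G : Set R[X]} {a b a' b' : ℝ}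
    (h : Matched φ ψ G a b a' b') : ∀ g ∈ G, specSign φ g b = specSign ψ g b' := by
  induction h with
  | base _ _ _ _ _ sb _ => exact sb
  | concat _ _ _ ih => exact ih

theorem Matched.lt {φ ψ : R →+* ℝ} {G : Set R[X]} {a b a' b' : ℝ}
    (h : Matched φ ψ G a b a' b') : a' < b' := by
  induction h with
  | base _ h _ _ _ _ _ => exact h
  | concat _ _ h₁ h₂ => exact h₁.trans h₂

/-- Sign conditions realized inside the first interval are realized inside the second. -/
theorem Matched.exists_mem {φ ψ : R →+* ℝ} {G : Set R[X]} {a b a' b' : ℝ}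
    (h : Matched φ ψ G a b a' b') :
    ∀ t ∈ Ioo a b, ∃ t' ∈ Ioo a' b', ∀ g ∈ G, specSign φ g t = specSign ψ g t' := by
  induction h with
  | @base a b a' b' hab hab' _ _ _ _ hG =>
    intro t ht
    obtain ⟨t', ht'⟩ := exists_between hab'
    refine ⟨t', ht', fun g hg => ?_⟩
    obtain ⟨τ, h1, h2⟩ := hG g hg
    rw [h1 t ht, h2 t' ht']
  | @concat a b c a' b' c' h₁ h₂ ih₁ ih₂ =>
    intro t ht
    rcases lt_trichotomy t b with htb | htb | htb
    · obtain ⟨t', ht', h⟩ := ih₁ t ⟨ht.1, htb⟩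
      exact ⟨t', ⟨ht'.1, ht'.2.trans h₂.lt⟩, h⟩
    · exact ⟨b', ⟨h₁.lt, h₂.lt⟩, htb ▸ h₁.sign_right⟩
    · obtain ⟨t', ht', h⟩ := ih₂ t ⟨htb, ht.2⟩
      exact ⟨t', ⟨h₁.lt.trans ht'.1, ht'.2⟩, h⟩

/-- A polynomial whose derivative belongs to `G`, and whose signs at corresponding break points
agree, can be added to `G`: its roots in the pieces become new break points. -/
theorem Matched.insert_of_derivative {φ ψ : R →+* ℝ} {G : Set R[X]} {f : R[X]}
    (hd : f.derivative = 0 ∨ f.derivative ∈ G)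
    (hφ : φ f.leadingCoeff ≠ 0) (hψ : ψ f.leadingCoeff ≠ 0)
    (hf : ∀ c c', Anchor φ ψ G c c' → (∀ g ∈ G, specSign φ g c = specSign ψ g c') →
      specSign φ f c = specSign ψ f c')
    {a b a' b' : ℝ} (h : Matched φ ψ G a b a' b') : Matched φ ψ (insert f G) a b a' b' := by
  induction h with
  | concat _ _ ih₁ ih₂ => exact ih₁.concat ih₂
  | @base a b a' b' hab hab' ha hb sa sb hG =>
    have fa := hf a a' ha sa
    have fb := hf b b' hb sb
    have hder : ∃ τ, (∀ t ∈ Ioo a b, SignType.sign ((f.map φ).derivative.eval t) = τ) ∧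
        ∀ t ∈ Ioo a' b', SignType.sign ((f.map ψ).derivative.eval t) = τ := by
      simp only [derivative_map]
      rcases hd with hd | hd
      · exact ⟨0, by simp [hd], by simp [hd]⟩
      · exact hG _ hd
    have hsub : G ⊆ insert f G := subset_insert f G
    have sa' : ∀ g ∈ insert f G, specSign φ g a = specSign ψ g a' :=
      forall_mem_insert.2 ⟨fa, sa⟩
    have sb' : ∀ g ∈ insert f G, specSign φ g b = specSign ψ g b' :=
      forall_mem_insert.2 ⟨fb, sb⟩
    rcases sameDiagram_of_derivative hab hab' hder fa fb with
      hτ | ⟨c, hc, c', hc', c0, c0', h1, h2⟩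
    · exact .base hab hab' (ha.mono hsub) (hb.mono hsub) sa' sb' (forall_mem_insert.2 ⟨hτ, hG⟩)
    · have hcc : Anchor φ ψ (insert f G) c c' :=
        Or.inr (Or.inr ⟨f, mem_insert f G, hφ, hψ, c0, c0'⟩)
      have sc : ∀ g ∈ insert f G, specSign φ g c = specSign ψ g c' := by
        refine forall_mem_insert.2 ⟨by simp [specSign, c0, c0'], fun g hg => ?_⟩
        obtain ⟨τ, h1, h2⟩ := hG g hg
        rw [h1 c hc, h2 c' hc']
      refine Matched.concat (b := c) (b' := c')
        (.base hc.1 hc'.1 (ha.mono hsub) hcc sa' sc (forall_mem_insert.2 ⟨h1, fun g hg => ?_⟩))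
        (.base hc.2 hc'.2 hcc (hb.mono hsub) sc sb' (forall_mem_insert.2 ⟨h2, fun g hg => ?_⟩))
      · obtain ⟨τ, h1, h2⟩ := hG g hg
        exact ⟨τ, fun t ht => h1 t ⟨ht.1, ht.2.trans hc.2⟩,
          fun t ht => h2 t ⟨ht.1, ht.2.trans hc'.2⟩⟩
      · obtain ⟨τ, h1, h2⟩ := hG g hg
        exact ⟨τ, fun t ht => h1 t ⟨hc.1.trans ht.1, ht.2⟩,
          fun t ht => h2 t ⟨hc'.1.trans ht.1, ht.2⟩⟩

/-- A polynomial that specializes to a polynomial of `G` can be added to `G`. -/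
theorem Matched.insert_of_map_eq {φ ψ : R →+* ℝ} {G : Set R[X]} {f g : R[X]}
    (hg : g = 0 ∨ g ∈ G) (hφ : f.map φ = g.map φ) (hψ : f.map ψ = g.map ψ)
    {a b a' b' : ℝ} (h : Matched φ ψ G a b a' b') : Matched φ ψ (insert f G) a b a' b' := by
  have hsub : G ⊆ insert f G := subset_insert f G
  have e1 : ∀ t, specSign φ f t = specSign φ g t := fun t => by rw [specSign, hφ, specSign]
  have e2 : ∀ t, specSign ψ f t = specSign ψ g t := fun t => by rw [specSign, hψ, specSign]
  have z1 : ∀ t, specSign φ (0 : R[X]) t = 0 := fun t => by simp [specSign]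
  have z2 : ∀ t, specSign ψ (0 : R[X]) t = 0 := fun t => by simp [specSign]
  induction h with
  | concat _ _ ih₁ ih₂ => exact ih₁.concat ih₂
  | @base a b a' b' hab hab' ha hb sa sb hG =>
    refine .base hab hab' (ha.mono hsub) (hb.mono hsub) (forall_mem_insert.2 ⟨?_, sa⟩)
      (forall_mem_insert.2 ⟨?_, sb⟩) (forall_mem_insert.2 ⟨?_, hG⟩)
    · rcases hg with rfl | hg
      · rw [e1, e2, z1, z2]
      · rw [e1, e2, sa g hg]
    · rcases hg with rfl | hg
      · rw [e1, e2, z1, z2]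
      · rw [e1, e2, sb g hg]
    · simp only [e1, e2]
      rcases hg with rfl | hg
      · exact ⟨0, fun t _ => z1 t, fun t _ => z2 t⟩
      · exact hG g hg

/-- Pseudo-division: after multiplication by an even power of the leading coefficient of `g`,
division with remainder by `g` is possible. -/
theorem exists_pseudo_remainder (g : R[X]) (hg : 1 ≤ g.natDegree) (f : R[X]) :
    ∃ (k : ℕ) (q r : R[X]), C (g.leadingCoeff ^ (2 * k)) * f = q * g + r ∧
      r.natDegree < g.natDegree := by
  induction hn : f.natDegree using Nat.strong_induction_on generalizing f with
  | _ n ih =>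
    rcases lt_or_ge f.natDegree g.natDegree with h | h
    · exact ⟨0, 0, f, by simp, h⟩
    set l := g.leadingCoeff with hl
    set q₀ : R[X] := C (l * f.leadingCoeff) * X ^ (f.natDegree - g.natDegree) with hq₀
    set f₁ := C (l ^ 2) * f - q₀ * g with hf₁
    have hlt : f₁.natDegree < n := by
      have hfn : 0 < n := by omega
      rcases eq_or_ne f₁ 0 with h0 | h0
      · rwa [h0, natDegree_zero]
      rw [natDegree_lt_iff_degree_lt h0, degree_lt_iff_coeff_zero]
      intro m hm
      rcases hm.lt_or_eq with hm | hm
      · have h1 : (C (l ^ 2) * f).coeff m = 0 := by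
          rw [coeff_C_mul, coeff_eq_zero_of_natDegree_lt (by omega), mul_zero]
        have h2 : (q₀ * g).coeff m = 0 := by
          rw [hq₀, mul_assoc, coeff_C_mul, coeff_X_pow_mul', if_pos (by omega),
            coeff_eq_zero_of_natDegree_lt (by omega), mul_zero]
        rw [hf₁, coeff_sub, h1, h2, sub_zero]
      · have h1 : g.coeff (m - (f.natDegree - g.natDegree)) = l := by
          rw [show m - (f.natDegree - g.natDegree) = g.natDegree by omega]; rfl
        have h2 : f.coeff m = f.leadingCoeff := by rw [← hm, ← hn]; rfl
        rw [hf₁, coeff_sub, hq₀, mul_assoc, coeff_C_mul, coeff_C_mul, coeff_X_pow_mul',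
          if_pos (by omega), h1, h2]
        ring
    obtain ⟨k, q, r, h1, h2⟩ := ih _ hlt f₁ rfl
    refine ⟨k + 1, q + C (l ^ (2 * k)) * q₀, r, ?_, h2⟩
    rw [hf₁, mul_sub, ← mul_assoc, ← C_mul] at h1
    rw [show l ^ (2 * (k + 1)) = l ^ (2 * k) * l ^ 2 by ring]
    linear_combination h1

/-- The family `G` is closed under derivatives, removal of the leading term, and remainders of
pseudo-division, as far as the members of degree at least `d` are concerned. -/
def ReductionClosed (d : ℕ) (G : Set R[X]) : Prop :=
  ∀ g ∈ G, d ≤ g.natDegree → g.derivative ∈ G ∧ g.eraseLead ∈ G ∧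
    ∀ f ∈ G, ∃ (k : ℕ) (q r : R[X]), C (g.leadingCoeff ^ (2 * k)) * f = q * g + r ∧
      r.natDegree < g.natDegree ∧ r ∈ G

theorem ReductionClosed.exists_succ_le {d : ℕ} {G : Set R[X]} (hG : G.Finite)
    (h : ReductionClosed (d + 2) G) :
    ∃ H : Set R[X], H.Finite ∧ G ⊆ H ∧ ReductionClosed (d + 1) H := by
  classical
  have hdiv : ∀ f g : R[X], ∃ r : R[X], 1 ≤ g.natDegree → ∃ (k : ℕ) (q : R[X]),
      C (g.leadingCoeff ^ (2 * k)) * f = q * g + r ∧ r.natDegree < g.natDegree := by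
    intro f g
    by_cases hg : 1 ≤ g.natDegree
    · obtain ⟨k, q, r, h⟩ := exists_pseudo_remainder g hg f
      exact ⟨r, fun _ => ⟨k, q, h⟩⟩
    · exact ⟨0, fun h => absurd h hg⟩
  choose rem hrem using hdiv
  set D : Set R[X] := {g ∈ G | g.natDegree = d + 1} with hD
  have hDf : D.Finite := hG.subset (sep_subset _ _)
  set N : Set R[X] := (derivative '' D ∪ eraseLead '' D) ∪ image2 rem G D with hN
  have hNf : N.Finite := ((hDf.image _).union (hDf.image _)).union (hG.image2 _ hDf)
  have hNdeg : ∀ f ∈ N, f.natDegree < d + 1 := by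
    rintro f ((⟨g, hg, rfl⟩ | ⟨g, hg, rfl⟩) | ⟨f, hf, g, hg, rfl⟩)
    · rw [← hg.2]
      exact natDegree_derivative_lt (by rw [hg.2]; omega)
    · have := g.eraseLead_natDegree_le
      rw [hg.2] at this
      omega
    · rw [← hg.2]
      obtain ⟨k, q, h1, h2⟩ := hrem f g (by rw [hg.2]; omega)
      exact h2
  refine ⟨G ∪ N, hG.union hNf, subset_union_left, fun g hg hdeg => ?_⟩
  have hgG : g ∈ G := hg.resolve_right fun h => absurd (hNdeg g h) (by omega)
  have low : ∀ f ∈ N, ∃ (k : ℕ) (q r : R[X]), C (g.leadingCoeff ^ (2 * k)) * f = q * g + r ∧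
      r.natDegree < g.natDegree ∧ r ∈ G ∪ N := fun f hf =>
    ⟨0, 0, f, by simp, (hNdeg f hf).trans_le hdeg, Or.inr hf⟩
  rcases hdeg.eq_or_lt with hdeg | hdeg
  · have hgD : g ∈ D := ⟨hgG, hdeg.symm⟩
    refine ⟨Or.inr (Or.inl (Or.inl ⟨g, hgD, rfl⟩)), Or.inr (Or.inl (Or.inr ⟨g, hgD, rfl⟩)), ?_⟩
    rintro f (hf | hf)
    · obtain ⟨k, q, h1, h2⟩ := hrem f g (by omega)
      exact ⟨k, q, rem f g, h1, h2, Or.inr (Or.inr ⟨f, hf, g, hgD, rfl⟩)⟩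
    · exact low f hf
  · obtain ⟨h1, h2, h3⟩ := h g hgG hdeg
    refine ⟨Or.inl h1, Or.inl h2, ?_⟩
    rintro f (hf | hf)
    · obtain ⟨k, q, r, e1, e2, e3⟩ := h3 f hf
      exact ⟨k, q, r, e1, e2, Or.inl e3⟩
    · exact low f hf

theorem exists_reductionClosed {G : Set R[X]} (hG : G.Finite) :
    ∃ H : Set R[X], H.Finite ∧ G ⊆ H ∧ ReductionClosed 1 H := by
  have main : ∀ (d : ℕ) (G : Set R[X]), G.Finite → ReductionClosed (d + 1) G →
      ∃ H : Set R[X], H.Finite ∧ G ⊆ H ∧ ReductionClosed 1 H := by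
    intro d
    induction d with
    | zero => exact fun G hG h => ⟨G, hG, Subset.rfl, h⟩
    | succ d ih =>
      intro G hG h
      obtain ⟨H, hH, hGH, h'⟩ := h.exists_succ_le hG
      obtain ⟨K, hK, hHK, h''⟩ := ih H hH h'
      exact ⟨K, hK, hGH.trans hHK, h''⟩
  obtain ⟨d, hd⟩ := (hG.image natDegree).bddAbove
  refine main d G hG fun g hg h => ?_
  have := hd (mem_image_of_mem _ hg)
  omega

/-- The parametric sign conditions which determine the sign diagram of a finite family of
polynomials over `[-1, 1]`. -/
theorem exists_finite_signs_determine (G : Set R[X]) (hG : G.Finite) :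
    ∃ C : Set R, C.Finite ∧ ∀ φ ψ : R →+* ℝ,
      (∀ c ∈ C, SignType.sign (φ c) = SignType.sign (ψ c)) →
      ∃ H : Set R[X], G ⊆ H ∧ Matched φ ψ H (-1) 1 (-1) 1 := by
  classical
  obtain ⟨H, hH, hGH, hcl⟩ := exists_reductionClosed hG
  refine ⟨leadingCoeff '' H ∪ (eval 1 '' H ∪ eval (-1) '' H),
    (hH.image _).union ((hH.image _).union (hH.image _)), fun φ ψ hs => ⟨H, hGH, ?_⟩⟩
  have hlead : ∀ f ∈ H, SignType.sign (φ f.leadingCoeff) = SignType.sign (ψ f.leadingCoeff) :=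
    fun f hf => hs _ (Or.inl ⟨f, hf, rfl⟩)
  have hone : ∀ f ∈ H, specSign φ f 1 = specSign ψ f 1 := by
    intro f hf
    have := hs _ (Or.inr (Or.inl ⟨f, hf, rfl⟩))
    have e : ∀ χ : R →+* ℝ, (f.map χ).eval 1 = χ (f.eval 1) := fun χ => by
      rw [← eval_map_apply, map_one]
    simpa only [specSign, e] using this
  have hneg : ∀ f ∈ H, specSign φ f (-1) = specSign ψ f (-1) := by
    intro f hf
    have := hs _ (Or.inr (Or.inr ⟨f, hf, rfl⟩))
    have e : ∀ χ : R →+* ℝ, (f.map χ).eval (-1) = χ (f.eval (-1)) := fun χ => by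
      rw [← eval_map_apply, map_neg, map_one]
    simpa only [specSign, e] using this
  -- The members of `H` are added one at a time in the order of their degrees.
  have main : ∀ s : Finset R[X], (s : Set R[X]) ⊆ H →
      (∀ f ∈ H, ∀ g ∈ s, f.natDegree < g.natDegree → f ∈ s) →
      Matched φ ψ (s : Set R[X]) (-1) 1 (-1) 1 := by
    intro s
    refine Finset.induction_on_max_value (motive := fun s : Finset R[X] => (s : Set R[X]) ⊆ H →
      (∀ f ∈ H, ∀ g ∈ s, f.natDegree < g.natDegree → f ∈ s) →
      Matched φ ψ (s : Set R[X]) (-1) 1 (-1) 1) natDegree s ?_ ?_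
    · intro _ _
      exact .base (by norm_num) (by norm_num) (Or.inl ⟨rfl, rfl⟩) (Or.inr (Or.inl ⟨rfl, rfl⟩))
        (by simp) (by simp) (by simp)
    · intro a s has hmax ih hsub hlow
      have haH : a ∈ H := hsub (by simp)
      have hsH : (s : Set R[X]) ⊆ H := fun x hx => hsub (by simp [Finset.mem_coe.1 hx])
      have hlow' : ∀ f ∈ H, f.natDegree < a.natDegree → f ∈ s := fun f hf hlt =>
        (Finset.mem_insert.1 (hlow f hf a (by simp) hlt)).resolve_left (by rintro rfl; simp at hlt)
      have hm := ih hsH fun f hf g hg hlt => hlow' f hf (hlt.trans_le (hmax g hg))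
      rw [Finset.coe_insert]
      have hl := hlead a haH
      by_cases hφ : φ a.leadingCoeff = 0
      · have hψ : ψ a.leadingCoeff = 0 := by
          rwa [hφ, sign_zero, eq_comm, sign_eq_zero_iff] at hl
        refine hm.insert_of_map_eq (g := a.eraseLead) ?_ ?_ ?_
        · rcases Nat.eq_zero_or_pos a.natDegree with h | h
          · left
            rw [eq_C_of_natDegree_eq_zero h]
            simp
          · right
            refine hlow' _ (hcl a haH h).2.1 ?_
            have := a.eraseLead_natDegree_le
            omega
        · conv_lhs => rw [← a.eraseLead_add_monomial_natDegree_leadingCoeff]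
          rw [Polynomial.map_add, map_monomial, hφ, monomial_zero_right, add_zero]
        · conv_lhs => rw [← a.eraseLead_add_monomial_natDegree_leadingCoeff]
          rw [Polynomial.map_add, map_monomial, hψ, monomial_zero_right, add_zero]
      · have hψ : ψ a.leadingCoeff ≠ 0 := by
          intro h
          rw [h, sign_zero, sign_eq_zero_iff] at hl
          exact hφ hl
        refine hm.insert_of_derivative ?_ hφ hψ ?_
        · rcases Nat.eq_zero_or_pos a.natDegree with h | h
          · left
            rw [eq_C_of_natDegree_eq_zero h, derivative_C]
          · right
            exact hlow' _ (hcl a haH h).1 (natDegree_derivative_lt h.ne')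
        · rintro c c' (⟨rfl, rfl⟩ | ⟨rfl, rfl⟩ | ⟨g, hg, gφ, gψ, g0, g0'⟩) hsign
          · exact hneg a haH
          · exact hone a haH
          · have hgd : 1 ≤ g.natDegree := by
              by_contra hlt
              have hgC := eq_C_of_natDegree_eq_zero (p := g) (by omega)
              rw [hgC] at g0 gφ
              simp only [map_C, eval_C, leadingCoeff_C] at g0 gφ
              exact gφ g0
            obtain ⟨k, q, r, h1, h2, h3⟩ := (hcl g (hsH hg) hgd).2.2 a haH
            have hr : r ∈ s := hlow' r h3 (h2.trans_le (hmax g hg))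
            have key : ∀ (χ : R →+* ℝ) (t : ℝ), χ g.leadingCoeff ≠ 0 → (g.map χ).eval t = 0 →
                specSign χ a t = specSign χ r t := by
              intro χ t hχ ht
              have h1' := congrArg (fun p => (p.map χ).eval t) h1
              simp only [Polynomial.map_mul, Polynomial.map_add, eval_mul, eval_add, map_C, eval_C,
                ht, mul_zero, zero_add] at h1'
              rw [map_pow] at h1'
              have hpos : 0 < χ g.leadingCoeff ^ (2 * k) := by
                rw [pow_mul]
                positivity
              rw [specSign, specSign, ← h1', sign_mul, sign_pos hpos, one_mul]
            rw [key φ c gφ g0, key ψ c' gψ g0', hsign r hr]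
  have := main hH.toFinset (by simp) (fun f hf g _ _ => by simpa using hf)
  simpa using this

end Elimination

section Semialgebraic

open Polynomial Set

variable {n : ℕ}

/-- A set which is a union of classes of points at which finitely many given polynomials have
the same signs is semialgebraic. -/
theorem isSemialgebraic_of_signs {S : Set (Fin n → ℝ)} {C : Set (MvPolynomial (Fin n) ℝ)}
    (hC : C.Finite)
    (h : ∀ u ∈ S, ∀ v, (∀ c ∈ C, SignType.sign (MvPolynomial.eval u c) =
      SignType.sign (MvPolynomial.eval v c)) → v ∈ S) : IsSemialgebraic S := by
  classical
  set F := hC.toFinset with hF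
  -- the sign class given by the positive, the negative and the vanishing members of `C`
  let cls : Finset (MvPolynomial (Fin n) ℝ) × Finset (MvPolynomial (Fin n) ℝ) →
      Finset (MvPolynomial (Fin n) ℝ) × MvPolynomial (Fin n) ℝ := fun P =>
    (P.1 ∪ P.2.image Neg.neg, ∑ c ∈ F \ (P.1 ∪ P.2), c ^ 2)
  let pat : (Fin n → ℝ) → Finset (MvPolynomial (Fin n) ℝ) × Finset (MvPolynomial (Fin n) ℝ) :=
    fun u => (F.filter fun c => 0 < MvPolynomial.eval u c,
      F.filter fun c => MvPolynomial.eval u c < 0)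
  have hmem : ∀ u v : Fin n → ℝ, ((∀ p ∈ (cls (pat u)).1, 0 < MvPolynomial.eval v p) ∧
      MvPolynomial.eval v (cls (pat u)).2 = 0) ↔ ∀ c ∈ C, SignType.sign (MvPolynomial.eval u c) =
      SignType.sign (MvPolynomial.eval v c) := by
    intro u v
    have hz : MvPolynomial.eval v (cls (pat u)).2 = 0 ↔
        ∀ c ∈ C, MvPolynomial.eval u c = 0 → MvPolynomial.eval v c = 0 := by
      simp only [cls, pat, map_sum, map_pow]
      rw [Finset.sum_eq_zero_iff_of_nonneg fun _ _ => sq_nonneg _]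
      refine ⟨fun H c hc h0 => ?_, fun H c hc => ?_⟩
      · exact pow_eq_zero_iff (two_ne_zero) |>.1 (H c (by simp [hF, hc, h0]))
      · simp only [hF, Finset.mem_sdiff, Finite.mem_toFinset, Finset.mem_union, Finset.mem_filter,
          not_or, not_and, not_lt] at hc
        rw [H c hc.1 (le_antisymm (hc.2.1 hc.1) (hc.2.2 hc.1)), zero_pow two_ne_zero]
    rw [hz]
    simp only [cls, pat, Finset.mem_union, Finset.mem_image, Finset.mem_filter, hF,
      Finite.mem_toFinset]
    constructor
    · rintro ⟨h1, h2⟩ c hc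
      rcases lt_trichotomy (MvPolynomial.eval u c) 0 with hlt | heq | hgt
      · have := h1 (-c) (Or.inr ⟨c, ⟨hc, hlt⟩, rfl⟩)
        rw [map_neg, neg_pos] at this
        rw [sign_neg hlt, sign_neg this]
      · rw [heq, h2 c hc heq]
      · rw [sign_pos hgt, sign_pos (h1 c (Or.inl ⟨hc, hgt⟩))]
    · refine fun H => ⟨?_, fun c hc h0 => ?_⟩
      · rintro p (⟨hp, hpos⟩ | ⟨c, ⟨hc, hneg⟩, rfl⟩)
        · rw [← sign_eq_one_iff, ← H p hp, sign_eq_one_iff]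
          exact hpos
        · rw [map_neg, neg_pos, ← sign_eq_neg_one_iff, ← H c hc, sign_eq_neg_one_iff]
          exact hneg
      · rw [← sign_eq_zero_iff, ← H c hc, h0, sign_zero]
  refine ⟨cls '' (pat '' S), ?_, ?_⟩
  · refine Finite.image _ (((F.powerset ×ˢ F.powerset).finite_toSet).subset ?_)
    rintro _ ⟨u, _, rfl⟩
    exact Finset.mem_coe.2 (Finset.mem_product.2
      ⟨Finset.mem_powerset.2 (Finset.filter_subset _ _),
        Finset.mem_powerset.2 (Finset.filter_subset _ _)⟩)
  · ext v
    simp only [mem_iUnion, mem_ofPred_eq, exists_prop, mem_image, exists_exists_and_eq_and, hmem]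
    exact ⟨fun hv => ⟨v, hv, fun _ _ => rfl⟩, fun ⟨u, hu, H⟩ => h u hu v H⟩

/-- The projection of a set given by finitely many strict polynomial inequalities, along a
variable running through `(-1, 1)`, is semialgebraic. -/
theorem isSemialgebraic_exists_mem_Ioo {G : Set (MvPolynomial (Fin n) ℝ)[X]} (hG : G.Finite) :
    IsSemialgebraic {u : Fin n → ℝ | ∃ t ∈ Ioo (-1 : ℝ) 1,
      ∀ g ∈ G, 0 < (g.map (MvPolynomial.eval u)).eval t} := by
  obtain ⟨C, hC, h⟩ := exists_finite_signs_determine G hG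
  refine isSemialgebraic_of_signs hC ?_
  rintro u ⟨t, ht, hu⟩ v hv
  obtain ⟨H, hGH, hm⟩ := h (MvPolynomial.eval u) (MvPolynomial.eval v) hv
  obtain ⟨t', ht', hs⟩ := hm.exists_mem t ht
  refine ⟨t', ht', fun g hg => ?_⟩
  have := hs g (hGH hg)
  rw [specSign, specSign, sign_pos (hu g hg)] at this
  exact sign_eq_one_iff.1 this.symm

end Semialgebraic

/-! ### Consequences of the numerical condition -/

theorem mul_lt_of_sum_div_lt_one {A B C p q r : ℝ} (hA : 0 < A) (hB : 0 < B) (hC : 0 < C)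
    (hp : 0 < p) (hq : 0 < q) (hr : 0 < r) (h : A / (A + p) + B / (B + q) + C / (C + r) < 1) :
    2 * (A * B * C) + p * B * C + A * q * C + A * B * r < p * q * r := by
  have h1 : 0 < A + p := by positivity
  have h2 : 0 < B + q := by positivity
  have h3 : 0 < C + r := by positivity
  rw [div_add_div _ _ h1.ne' h2.ne', div_add_div _ _ (by positivity) h3.ne',
    div_lt_one (by positivity)] at h
  nlinarith

/-- The inequalities between the `δ i j` on which the argument rests: the exponent matrix
restricted to `x₁, x₂, x₃` has positive determinant, and an arm of the star along one coordinate
axis satisfies the conditions attached to the other axes. -/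
structure Admissible (δ : Fin 3 → Fin 4 → ℕ) : Prop where
  pos : ∀ i j : Fin 3, 1 ≤ δ i j.castSucc
  diag_le : ∀ i j : Fin 3, i ≠ j →
    δ i i.castSucc * δ j j.castSucc ≤ δ i j.castSucc * δ j i.castSucc
  det_pos : (δ 0 0 * δ 1 1 * δ 2 2 : ℤ) < δ 0 1 * δ 1 2 * δ 2 0 + δ 0 2 * δ 1 0 * δ 2 1 +
    δ 0 0 * δ 1 2 * δ 2 1 + δ 1 1 * δ 0 2 * δ 2 0 + δ 2 2 * δ 0 1 * δ 1 0

theorem Admissible.of_sum_lt_one {δ : Fin 3 → Fin 4 → ℕ}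
    (hδ : ∀ i j : Fin 3, 1 ≤ δ i j.castSucc)
    (hcond :
      (δ 0 0 : ℝ) / ((δ 0 0 : ℝ) + min (δ 1 0 : ℝ) (δ 2 0 : ℝ))
        + (δ 1 1 : ℝ) / ((δ 1 1 : ℝ) + min (δ 0 1 : ℝ) (δ 2 1 : ℝ))
        + (δ 2 2 : ℝ) / ((δ 2 2 : ℝ) + min (δ 0 2 : ℝ) (δ 1 2 : ℝ)) < 1) : Admissible δ := by
  have hpos : ∀ i j : Fin 3, (0 : ℝ) < δ i j.castSucc := fun i j => by
    exact_mod_cast hδ i j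
  have d00 := hpos 0 0
  have d01 := hpos 0 1
  have d02 := hpos 0 2
  have d10 := hpos 1 0
  have d11 := hpos 1 1
  have d12 := hpos 1 2
  have d20 := hpos 2 0
  have d21 := hpos 2 1
  have d22 := hpos 2 2
  simp only [Fin.castSucc_zero, Fin.castSucc_one, show (2 : Fin 3).castSucc = 2 from rfl] at *
  have hp : 0 < min (δ 1 0 : ℝ) (δ 2 0 : ℝ) := lt_min d10 d20
  have hq : 0 < min (δ 0 1 : ℝ) (δ 2 1 : ℝ) := lt_min d01 d21
  have hr : 0 < min (δ 0 2 : ℝ) (δ 1 2 : ℝ) := lt_min d02 d12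
  have key := mul_lt_of_sum_div_lt_one d00 d11 d22 hp hq hr hcond
  have p1 := min_le_left (δ 1 0 : ℝ) (δ 2 0 : ℝ)
  have p2 := min_le_right (δ 1 0 : ℝ) (δ 2 0 : ℝ)
  have q1 := min_le_left (δ 0 1 : ℝ) (δ 2 1 : ℝ)
  have q2 := min_le_right (δ 0 1 : ℝ) (δ 2 1 : ℝ)
  have r1 := min_le_left (δ 0 2 : ℝ) (δ 1 2 : ℝ)
  have r2 := min_le_right (δ 0 2 : ℝ) (δ 1 2 : ℝ)
  generalize min (δ 1 0 : ℝ) (δ 2 0 : ℝ) = p at *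
  generalize min (δ 0 1 : ℝ) (δ 2 1 : ℝ) = q at *
  generalize min (δ 0 2 : ℝ) (δ 1 2 : ℝ) = r at *
  have t0 : 0 < (δ 0 0 : ℝ) * δ 1 1 * δ 2 2 := by positivity
  have t1 : 0 < p * δ 1 1 * δ 2 2 := by positivity
  have t2 : 0 < (δ 0 0 : ℝ) * q * δ 2 2 := by positivity
  have t3 : 0 < (δ 0 0 : ℝ) * δ 1 1 * r := by positivity
  have hpq : (δ 0 0 : ℝ) * δ 1 1 ≤ p * q := by
    refine le_of_mul_le_mul_right ?_ hr
    linarith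
  have hpr : (δ 0 0 : ℝ) * δ 2 2 ≤ p * r := by
    refine le_of_mul_le_mul_right ?_ hq
    linarith
  have hqr : (δ 1 1 : ℝ) * δ 2 2 ≤ q * r := by
    refine le_of_mul_le_mul_right ?_ hp
    linarith
  have e01 : δ 0 0 * δ 1 1 ≤ δ 0 1 * δ 1 0 := by
    have : (δ 0 0 : ℝ) * δ 1 1 ≤ δ 0 1 * δ 1 0 := by
      rw [mul_comm (δ 0 1 : ℝ)]
      exact hpq.trans (mul_le_mul p1 q1 hq.le d10.le)
    exact_mod_cast this
  have e02 : δ 0 0 * δ 2 2 ≤ δ 0 2 * δ 2 0 := by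
    have : (δ 0 0 : ℝ) * δ 2 2 ≤ δ 0 2 * δ 2 0 := by
      rw [mul_comm (δ 0 2 : ℝ)]
      exact hpr.trans (mul_le_mul p2 r1 hr.le d20.le)
    exact_mod_cast this
  have e12 : δ 1 1 * δ 2 2 ≤ δ 1 2 * δ 2 1 := by
    have : (δ 1 1 : ℝ) * δ 2 2 ≤ δ 1 2 * δ 2 1 := by
      rw [mul_comm (δ 1 2 : ℝ)]
      exact hqr.trans (mul_le_mul q2 r2 hr.le d21.le)
    exact_mod_cast this
  refine ⟨hδ, ?_, ?_⟩
  · intro i j hij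
    fin_cases i <;> fin_cases j <;> first | exact absurd rfl hij | skip
    · exact e01
    · exact e02
    · exact (mul_comm _ _).trans_le (e01.trans_eq (mul_comm _ _))
    · exact e12
    · exact (mul_comm _ _).trans_le (e02.trans_eq (mul_comm _ _))
    · exact (mul_comm _ _).trans_le (e12.trans_eq (mul_comm _ _))
  · have h1 : p * q * r ≤ δ 2 0 * δ 0 1 * δ 1 2 :=
      mul_le_mul (mul_le_mul p2 q1 hq.le d20.le) r2 hr.le (by positivity)
    have h2 : (0 : ℝ) < δ 0 2 * δ 1 0 * δ 2 1 := by positivity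
    have h3 : (0 : ℝ) < δ 0 0 * δ 1 2 * δ 2 1 := by positivity
    have h4 : (0 : ℝ) < δ 1 1 * δ 0 2 * δ 2 0 := by positivity
    have h5 : (0 : ℝ) < δ 2 2 * δ 0 1 * δ 1 0 := by positivity
    have : (δ 0 0 * δ 1 1 * δ 2 2 : ℝ) < δ 0 1 * δ 1 2 * δ 2 0 + δ 0 2 * δ 1 0 * δ 2 1 +
        δ 0 0 * δ 1 2 * δ 2 1 + δ 1 1 * δ 0 2 * δ 2 0 + δ 2 2 * δ 0 1 * δ 1 0 := by linarith
    exact_mod_cast this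

/-! ### Polynomials with restricted support -/

/-- The algebra of polynomials all of whose exponents lie in a given submonoid. -/
noncomputable def supportAlgebra (M : AddSubmonoid (Fin 4 →₀ ℕ)) :
    Subalgebra ℝ (MvPolynomial (Fin 4) ℝ) where
  carrier := {p | ∀ n ∈ p.support, n ∈ M}
  mul_mem' := by
    classical
    intro p q hp hq n hn
    obtain ⟨a, ha, b, hb, rfl⟩ := Finset.mem_add.1 (MvPolynomial.support_mul p q hn)
    exact M.add_mem (hp a ha) (hq b hb)
  add_mem' := by
    classical
    intro p q hp hq n hn
    exact (Finset.mem_union.1 (MvPolynomial.support_add hn)).elim (hp n) (hq n)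
  algebraMap_mem' := by
    classical
    intro r n hn
    rw [MvPolynomial.algebraMap_eq, MvPolynomial.mem_support_iff, MvPolynomial.coeff_C] at hn
    by_cases h : 0 = n
    · exact h ▸ M.zero_mem
    · simp [h] at hn

/-- The exponent of `x_j` in the Laurent monomial `y ^ n`, for `j = 1, 2, 3`. -/
def weight (δ : Fin 3 → Fin 4 → ℕ) (j : Fin 3) (n : Fin 4 →₀ ℕ) : ℤ :=
  ∑ l : Fin 3, expVec δ l j.castSucc * (n l.castSucc : ℤ)

/-- The exponents `n` for which `y ^ n` is a polynomial in the `x_j`; nonnegativity of the exponent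
of `x₄` is automatic and not part of the definition. -/
def cone (δ : Fin 3 → Fin 4 → ℕ) : AddSubmonoid (Fin 4 →₀ ℕ) where
  carrier := {n | ∀ j, 0 ≤ weight δ j n}
  zero_mem' := fun j => by simp [weight]
  add_mem' := fun {a b} ha hb j => by
    have : weight δ j (a + b) = weight δ j a + weight δ j b := by
      simp [weight, mul_add, Finset.sum_add_distrib]
    rw [this]
    exact add_nonneg (ha j) (hb j)

theorem mem_cone {δ : Fin 3 → Fin 4 → ℕ} {n : Fin 4 →₀ ℕ} :
    n ∈ cone δ ↔ ∀ j, 0 ≤ weight δ j n := Iff.rfl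

theorem expVec_diag (δ : Fin 3 → Fin 4 → ℕ) (i : Fin 3) :
    expVec δ i i.castSucc = -(δ i i.castSucc : ℤ) := if_pos rfl

theorem expVec_of_ne (δ : Fin 3 → Fin 4 → ℕ) {i : Fin 3} {j : Fin 4} (h : j ≠ i.castSucc) :
    expVec δ i j = (δ i j : ℤ) := if_neg h

theorem expVec_castSucc_of_ne (δ : Fin 3 → Fin 4 → ℕ) {i j : Fin 3} (h : j ≠ i) :
    expVec δ i j.castSucc = (δ i j.castSucc : ℤ) :=
  expVec_of_ne δ fun e => h (Fin.castSucc_injective _ e)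

theorem univ_eq_of_ne {i j k : Fin 3} (hij : i ≠ j) (hik : i ≠ k) (hjk : j ≠ k) :
    (Finset.univ : Finset (Fin 3)) = {i, j, k} := by
  revert i j k
  decide

theorem weight_eq (δ : Fin 3 → Fin 4 → ℕ) {i j k : Fin 3} (hij : i ≠ j) (hik : i ≠ k)
    (hjk : j ≠ k) (n : Fin 4 →₀ ℕ) :
    weight δ i n = δ j i.castSucc * n j.castSucc + δ k i.castSucc * n k.castSucc -
      δ i i.castSucc * n i.castSucc := by
  rw [weight, univ_eq_of_ne hij hik hjk, Finset.sum_insert (by simp [hij, hik]),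
    Finset.sum_pair hjk, expVec_diag, expVec_castSucc_of_ne δ hij, expVec_castSucc_of_ne δ hik]
  ring

theorem exists_others (i : Fin 3) : ∃ j k : Fin 3, i ≠ j ∧ i ≠ k ∧ j ≠ k := by
  revert i
  decide

theorem mem_cone_iff {δ : Fin 3 → Fin 4 → ℕ} {n : Fin 4 →₀ ℕ} :
    n ∈ cone δ ↔ ∀ i j k : Fin 3, i ≠ j → i ≠ k → j ≠ k →
      δ i i.castSucc * n i.castSucc ≤
        δ j i.castSucc * n j.castSucc + δ k i.castSucc * n k.castSucc := by
  rw [mem_cone]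
  constructor
  · intro h i j k hij hik hjk
    have := h i
    rw [weight_eq δ hij hik hjk, sub_nonneg] at this
    exact_mod_cast this
  · intro h i
    obtain ⟨j, k, hij, hik, hjk⟩ := exists_others i
    rw [weight_eq δ hij hik hjk, sub_nonneg]
    exact_mod_cast h i j k hij hik hjk

/-! ### Bounded polynomials on the star -/

theorem prod_four_eq {i j k : Fin 3} (hij : i ≠ j) (hik : i ≠ k) (hjk : j ≠ k) (F : Fin 4 → ℝ) :
    ∏ l, F l = F i.castSucc * F j.castSucc * F k.castSucc * F 3 := by
  rw [Fin.prod_univ_castSucc, univ_eq_of_ne hij hik hjk, Finset.prod_insert (by simp [hij, hik]),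
    Finset.prod_pair hjk]
  rw [show Fin.last 3 = 3 from rfl]
  ring

/-- The monomials with exponents in the cone are bounded by `1` on the star. -/
theorem abs_monomial_le_one {δ : Fin 3 → Fin 4 → ℕ} (hδ : Admissible δ) {n : Fin 4 →₀ ℕ}
    (hn : n ∈ cone δ) {b : Fin 4 → ℝ} (hb : b ∈ starSet δ) : |∏ l, b l ^ n l| ≤ 1 := by
  rw [Finset.abs_prod]
  by_cases h : ∀ i : Fin 3, |b i.castSucc| ≤ 1
  · refine Finset.prod_le_one (fun l _ => abs_nonneg _) fun l _ => ?_
    rw [abs_pow]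
    refine pow_le_one₀ (abs_nonneg _) ?_
    induction l using Fin.lastCases with
    | last => exact hb.2.le
    | cast i => exact h i
  -- At most one coordinate is large; the monomial is a product of the functions defining the
  -- star after raising it to the power `δ i i`.
  push Not at h
  obtain ⟨i, hi⟩ := h
  obtain ⟨j, k, hij, hik, hjk⟩ := exists_others i
  rw [prod_four_eq hij hik hjk]
  have hb4 : |b 3 ^ n 3| ≤ 1 := by
    rw [abs_pow]
    exact pow_le_one₀ (abs_nonneg _) hb.2.le
  refine mul_le_one₀ ?_ (abs_nonneg _) hb4
  have hj := (hb.1 i j hij).le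
  have hk := (hb.1 i k hik).le
  have hc := mem_cone_iff.1 hn i j k hij hik hjk
  simp only [abs_mul, abs_pow] at hj hk ⊢
  set s := |b i.castSucc|
  set y := |b j.castSucc|
  set z := |b k.castSucc|
  have hy : 0 ≤ y := abs_nonneg _
  have hz : 0 ≤ z := abs_nonneg _
  have hs : 1 ≤ s := hi.le
  set d := δ i i.castSucc
  have hd : d ≠ 0 := by
    have := hδ.pos i i
    exact Nat.one_le_iff_ne_zero.1 this
  refine (pow_le_one_iff_of_nonneg (by positivity) hd).1 ?_
  calc (s ^ n i.castSucc * y ^ n j.castSucc * z ^ n k.castSucc) ^ d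
      = s ^ (d * n i.castSucc) * (y ^ d) ^ n j.castSucc * (z ^ d) ^ n k.castSucc := by ring
    _ ≤ s ^ (δ j i.castSucc * n j.castSucc + δ k i.castSucc * n k.castSucc) *
        (y ^ d) ^ n j.castSucc * (z ^ d) ^ n k.castSucc := by
        gcongr
    _ = (s ^ δ j i.castSucc * y ^ d) ^ n j.castSucc *
        (s ^ δ k i.castSucc * z ^ d) ^ n k.castSucc := by ring
    _ ≤ 1 := mul_le_one₀ (pow_le_one₀ (by positivity) hj) (by positivity)
        (pow_le_one₀ (by positivity) hk)

theorem supportAlgebra_cone_le {δ : Fin 3 → Fin 4 → ℕ} (hδ : Admissible δ) (r : ℝ) :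
    supportAlgebra (cone δ) ≤ boundedPolynomials (r • starSet δ) := by
  intro p hp
  refine ⟨∑ n ∈ p.support, |p.coeff n| * |∏ l, r ^ n l|, ?_⟩
  rintro _ ⟨b, hb, rfl⟩
  rw [MvPolynomial.eval_eq']
  refine (Finset.abs_sum_le_sum_abs _ _).trans (Finset.sum_le_sum fun n hn => ?_)
  simp only [Pi.smul_apply, smul_eq_mul, mul_pow, Finset.prod_mul_distrib]
  rw [abs_mul, abs_mul]
  gcongr
  exact mul_le_of_le_one_right (abs_nonneg _) (abs_monomial_le_one hδ (hp n hn) hb)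

/-- A Laurent polynomial that is bounded on `[1, ∞)` has no terms of positive degree; here the
`a`-th term has degree `-w a`. -/
theorem sum_filter_eq_zero_of_bounded {ι : Type*} (s : Finset ι) (w : ι → ℤ) (A : ι → ℝ) {c : ℝ}
    (h : ∀ t : ℝ, 1 ≤ t → |∑ a ∈ s, A a * t ^ (-w a)| ≤ c) {k : ℤ} (hk : k < 0) :
    ∑ a ∈ s with w a = k, A a = 0 := by
  obtain ⟨N, hN⟩ : ∃ N : ℕ, ∀ a ∈ s, w a ≤ N := by
    refine ⟨∑ a ∈ s, (w a).natAbs, fun a ha => ?_⟩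
    have := Finset.single_le_sum (f := fun a => (w a).natAbs) (fun _ _ => Nat.zero_le _) ha
    omega
  set q : Polynomial ℝ := ∑ a ∈ s, Polynomial.monomial (N - w a).toNat (A a) with hq
  have hqe : ∀ t : ℝ, 1 ≤ t → q.eval t = t ^ N * ∑ a ∈ s, A a * t ^ (-w a) := by
    intro t ht
    have ht0 : t ≠ 0 := by positivity
    rw [hq, Polynomial.eval_finsetSum, Finset.mul_sum]
    refine Finset.sum_congr rfl fun a ha => ?_
    rw [Polynomial.eval_monomial, ← zpow_natCast, ← zpow_natCast,
      Int.toNat_of_nonneg (sub_nonneg.2 (hN a ha)), sub_eq_add_neg, zpow_add₀ ht0]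
    ring
  have hdeg : q.degree ≤ (Polynomial.X ^ N : Polynomial ℝ).degree := by
    by_contra! hlt
    have htop := Polynomial.abs_div_tendsto_atTop_atTop_of_degree_gt q (Polynomial.X ^ N) hlt
      (pow_ne_zero _ Polynomial.X_ne_zero)
    obtain ⟨t, hlarge, ht⟩ :=
      ((htop.eventually_gt_atTop c).and (Filter.eventually_ge_atTop 1)).exists
    have ht0 : t ≠ 0 := by positivity
    rw [hqe t ht, Polynomial.eval_pow, Polynomial.eval_X,
      mul_div_cancel_left₀ _ (pow_ne_zero _ ht0)] at hlarge
    exact hlarge.not_ge (h t ht)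
  rw [Polynomial.degree_X_pow] at hdeg
  have hcoef : q.coeff (N - k).toNat = 0 :=
    Polynomial.coeff_eq_zero_of_degree_lt (hdeg.trans_lt (by norm_cast; omega))
  rw [hq, Polynomial.finsetSum_coeff] at hcoef
  rw [Finset.sum_filter]
  refine Eq.trans ?_ hcoef
  refine Finset.sum_congr rfl fun a ha => ?_
  rw [Polynomial.coeff_monomial]
  have := hN a ha
  refine if_congr ?_ rfl rfl
  omega

/-- The arm of the star along the `i`-th axis, filled by curves with monomial coordinates. -/
theorem arm_mem_starSet {δ : Fin 3 → Fin 4 → ℕ} (hδ : Admissible δ) (i : Fin 3) {c : Fin 4 → ℝ}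
    (hc : ∀ l, |c l| < 1) {t : ℝ} (ht : 1 ≤ t) :
    (Fin.snoc (fun l : Fin 3 => c l.castSucc * t ^ (-expVec δ l i.castSucc)) (c 3) : Fin 4 → ℝ) ∈
      starSet δ := by
  have ht0 : 0 < t := by positivity
  refine ⟨fun a a' ha => ?_, ?_⟩
  · simp only [Fin.snoc_castSucc]
    have hexp : 0 ≤ expVec δ a i.castSucc * δ a' a.castSucc +
        expVec δ a' i.castSucc * δ a a.castSucc := by
      by_cases h1 : i = a
      · subst h1
        rw [expVec_diag, expVec_castSucc_of_ne δ ha]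
        exact le_of_eq (by ring)
      by_cases h2 : i = a'
      · subst h2
        rw [expVec_diag, expVec_castSucc_of_ne δ ha.symm]
        have := hδ.diag_le i a ha.symm
        zify at this
        linarith
      · rw [expVec_castSucc_of_ne δ h1, expVec_castSucc_of_ne δ h2]
        positivity
    have e : (c a.castSucc * t ^ (-expVec δ a i.castSucc)) ^ δ a' a.castSucc *
        (c a'.castSucc * t ^ (-expVec δ a' i.castSucc)) ^ δ a a.castSucc =
        c a.castSucc ^ δ a' a.castSucc * c a'.castSucc ^ δ a a.castSucc *
          t ^ (-(expVec δ a i.castSucc * δ a' a.castSucc +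
            expVec δ a' i.castSucc * δ a a.castSucc)) := by
      rw [mul_pow, mul_pow, ← zpow_natCast (t ^ _), ← zpow_natCast (t ^ _), ← zpow_mul,
        ← zpow_mul, neg_add, zpow_add₀ ht0.ne', neg_mul, neg_mul]
      ring
    rw [e, abs_mul, abs_mul, abs_pow, abs_pow, abs_of_pos (zpow_pos ht0 _)]
    have h1 : |c a.castSucc| ^ δ a' a.castSucc < 1 :=
      pow_lt_one₀ (abs_nonneg _) (hc _) (Nat.one_le_iff_ne_zero.1 (hδ.pos a' a))
    have h2 : |c a'.castSucc| ^ δ a a.castSucc ≤ 1 := pow_le_one₀ (abs_nonneg _) (hc _).le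
    have h3 : t ^ (-(expVec δ a i.castSucc * δ a' a.castSucc +
        expVec δ a' i.castSucc * δ a a.castSucc)) ≤ 1 :=
      zpow_le_one_of_nonpos₀ ht (by linarith)
    refine (mul_le_of_le_one_right (by positivity) h3).trans_lt ?_
    exact (mul_le_of_le_one_right (by positivity) h2).trans_lt h1
  · rw [show (3 : Fin 4) = Fin.last 3 from rfl, Fin.snoc_last]
    exact hc _

/-- The polynomials bounded on a multiple of the star are those with support in the cone. -/
theorem boundedPolynomials_starSet {δ : Fin 3 → Fin 4 → ℕ} (hδ : Admissible δ) {r : ℝ}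
    (hr : 0 < r) : boundedPolynomials (r • starSet δ) = supportAlgebra (cone δ) := by
  refine le_antisymm ?_ (supportAlgebra_cone_le hδ r)
  rintro p ⟨B, hB⟩ n hn i
  by_contra! hneg
  -- the part of `p` of weight `weight δ i n` vanishes on an open cube
  set p' : MvPolynomial (Fin 4) ℝ :=
    ∑ m ∈ p.support with weight δ i m = weight δ i n, MvPolynomial.monomial m (p.coeff m) with hp'
  have hzero : p' = 0 := by
    refine MvPolynomial.funext_set (fun _ => Set.Ioo (-r) r)
      (fun _ => Set.Ioo_infinite (by linarith)) fun x hx => ?_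
    have hx' : ∀ l, |x l / r| < 1 := fun l => by
      rw [abs_div, abs_of_pos hr, div_lt_one hr]
      exact abs_lt.2 (hx l trivial)
    have key := sum_filter_eq_zero_of_bounded p.support (weight δ i)
      (fun m => p.coeff m * ∏ l, x l ^ m l) (c := B) (fun t ht => ?_) hneg
    · rw [map_zero, hp', map_sum, ← key]
      refine Finset.sum_congr rfl fun m _ => ?_
      rw [MvPolynomial.eval_monomial, Finsupp.prod_fintype _ _ (by simp)]
    · have ht0 : t ≠ 0 := by positivity
      have := hB _ (Set.smul_mem_smul_set (arm_mem_starSet hδ i hx' ht))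
      rw [MvPolynomial.eval_eq'] at this
      convert this using 3 with m hm
      rw [mul_assoc]
      congr 1
      have e1 : ∀ F : Fin 4 → ℝ, ∏ l, F l = (∏ l : Fin 3, F l.castSucc) * F (Fin.last 3) :=
        fun F => Fin.prod_univ_castSucc F
      rw [e1, e1, mul_right_comm]
      simp only [Pi.smul_apply, smul_eq_mul, Fin.snoc_castSucc, Fin.snoc_last]
      congr 1
      · have e2 : t ^ (-weight δ i m) =
            ∏ l : Fin 3, t ^ (-expVec δ l i.castSucc * (m l.castSucc : ℤ)) := by
          rw [weight, Fin.sum_univ_three, Fin.prod_univ_three, ← zpow_add₀ ht0, ← zpow_add₀ ht0]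
          congr 1
          ring
        rw [e2, ← Finset.prod_mul_distrib]
        refine Finset.prod_congr rfl fun l _ => ?_
        rw [← mul_assoc, mul_div_cancel₀ _ hr.ne', mul_pow, ← zpow_natCast (t ^ _), ← zpow_mul]
      · rw [show Fin.last 3 = 3 from rfl, mul_div_cancel₀ _ hr.ne']
  have hcoef := congrArg (MvPolynomial.coeff n) hzero
  rw [hp', MvPolynomial.coeff_sum, MvPolynomial.coeff_zero] at hcoef
  simp only [MvPolynomial.coeff_monomial] at hcoef
  rw [Finset.sum_ite_eq_of_mem' _ _ _ (by simp [MvPolynomial.mem_support_iff.1 hn])] at hcoef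
  exact MvPolynomial.mem_support_iff.1 hn hcoef

/-! ### The star and its projection are open and semialgebraic -/

theorem abs_lt_one_iff_one_sub_sq_pos {a : ℝ} : |a| < 1 ↔ 0 < 1 - a ^ 2 := by
  rw [sub_pos, sq_lt_one_iff_abs_lt_one]

theorem isOpen_starSet (δ : Fin 3 → Fin 4 → ℕ) : IsOpen (starSet δ) := by
  have : starSet δ = (⋂ i : Fin 3, ⋂ j : Fin 3, ⋂ _ : i ≠ j,
      {b | |b i.castSucc ^ δ j i.castSucc * b j.castSucc ^ δ i i.castSucc| < 1}) ∩
        {b | |b 3| < 1} := by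
    ext b
    simp [starSet]
  rw [this]
  refine IsOpen.inter ?_ (isOpen_lt (by fun_prop) continuous_const)
  exact isOpen_iInter_of_finite fun i => isOpen_iInter_of_finite fun j =>
    isOpen_iInter_of_finite fun _ => isOpen_lt (by fun_prop) continuous_const

theorem isSemialgebraic_starSet (δ : Fin 3 → Fin 4 → ℕ) : IsSemialgebraic (starSet δ) := by
  classical
  let P : Fin 3 × Fin 3 → MvPolynomial (Fin 4) ℝ := fun a =>
    1 - (MvPolynomial.X a.1.castSucc ^ δ a.2 a.1.castSucc *
      MvPolynomial.X a.2.castSucc ^ δ a.1 a.1.castSucc) ^ 2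
  refine ⟨{(insert (1 - MvPolynomial.X 3 ^ 2)
    ((Finset.univ.filter fun a : Fin 3 × Fin 3 => a.1 ≠ a.2).image P), 0)},
    Set.finite_singleton _, ?_⟩
  ext b
  simp only [starSet, Set.mem_ofPred_eq, Set.mem_singleton_iff, Set.iUnion_iUnion_eq_left,
    Finset.forall_mem_insert, Finset.forall_mem_image, Finset.mem_filter, Finset.mem_univ,
    true_and, Prod.forall, map_zero, and_true, P, map_sub, map_one, map_pow, map_mul,
    MvPolynomial.eval_X, abs_lt_one_iff_one_sub_sq_pos]
  exact and_comm

theorem mem_projStar {δ : Fin 3 → Fin 4 → ℕ} {u : Fin 3 → ℝ} :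
    u ∈ projStar δ ↔ ∃ t : ℝ,
      (Fin.snoc (fun i => u i + t) t : Fin 4 → ℝ) ∈ starSet δ := by
  constructor
  · rintro ⟨b, hb, rfl⟩
    refine ⟨b 3, ?_⟩
    convert hb using 1
    ext l
    induction l using Fin.lastCases with
    | last => simp only [Fin.snoc_last]; rfl
    | cast i => simp [diagProj]
  · rintro ⟨t, ht⟩
    refine ⟨_, ht, ?_⟩
    ext i
    rw [diagProj, Fin.snoc_castSucc, show (3 : Fin 4) = Fin.last 3 from rfl, Fin.snoc_last]
    ring

theorem isOpen_projStar (δ : Fin 3 → Fin 4 → ℕ) : IsOpen (projStar δ) := by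
  have : projStar δ = ⋃ t : ℝ, (fun u : Fin 3 → ℝ =>
      (Fin.snoc (fun i => u i + t) t : Fin 4 → ℝ)) ⁻¹' starSet δ := by
    ext u
    simp [mem_projStar]
  rw [this]
  refine isOpen_iUnion fun t => (isOpen_starSet δ).preimage (continuous_pi fun l => ?_)
  induction l using Fin.lastCases with
  | last => simpa only [Fin.snoc_last] using continuous_const
  | cast i => simp only [Fin.snoc_castSucc]; fun_prop

theorem isSemialgebraic_projStar (δ : Fin 3 → Fin 4 → ℕ) : IsSemialgebraic (projStar δ) := by
  let L : Fin 3 → Polynomial (MvPolynomial (Fin 3) ℝ) := fun i =>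
    Polynomial.C (MvPolynomial.X i) + Polynomial.X
  let P : Fin 3 × Fin 3 → Polynomial (MvPolynomial (Fin 3) ℝ) := fun a =>
    1 - (L a.1 ^ δ a.2 a.1.castSucc * L a.2 ^ δ a.1 a.1.castSucc) ^ 2
  convert isSemialgebraic_exists_mem_Ioo (G := P '' {a | a.1 ≠ a.2}) (Set.toFinite _) using 1
  ext u
  rw [mem_projStar]
  refine exists_congr fun t => ?_
  rw [and_comm]
  simp only [starSet, Set.mem_ofPred_eq, Set.forall_mem_image, Prod.forall, Fin.snoc_castSucc]
  refine and_congr ?_ ?_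
  · simp only [abs_lt_one_iff_one_sub_sq_pos, P, L, Polynomial.map_sub, Polynomial.map_one,
      Polynomial.map_pow, Polynomial.map_mul, Polynomial.map_add, Polynomial.map_C,
      Polynomial.map_X, Polynomial.eval_sub, Polynomial.eval_one, Polynomial.eval_pow,
      Polynomial.eval_mul, Polynomial.eval_add, Polynomial.eval_C, Polynomial.eval_X,
      MvPolynomial.eval_X]
  · rw [show (3 : Fin 4) = Fin.last 3 from rfl, Fin.snoc_last, abs_lt]
    rfl

/-! ### Pulling polynomials back along the projection -/

/-- Composition of polynomials with the projection along the diagonal. -/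
noncomputable def diagHom : MvPolynomial (Fin 3) ℝ →ₐ[ℝ] MvPolynomial (Fin 4) ℝ :=
  MvPolynomial.aeval fun i => MvPolynomial.X i.castSucc - MvPolynomial.X 3

/-- The restriction of polynomials to the section `u ↦ (u₁ + c, u₂ + c, u₃ + c, c)` of the
projection along the diagonal. -/
noncomputable def sectionHom (c : MvPolynomial (Fin 3) ℝ) :
    MvPolynomial (Fin 4) ℝ →ₐ[ℝ] MvPolynomial (Fin 3) ℝ :=
  MvPolynomial.aeval (Fin.snoc (fun i => MvPolynomial.X i + c) c : Fin 4 → _)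

theorem sectionHom_X_castSucc (c : MvPolynomial (Fin 3) ℝ) (i : Fin 3) :
    sectionHom c (MvPolynomial.X i.castSucc) = MvPolynomial.X i + c := by
  rw [sectionHom, MvPolynomial.aeval_X, Fin.snoc_castSucc]

theorem sectionHom_X_last (c : MvPolynomial (Fin 3) ℝ) :
    sectionHom c (MvPolynomial.X 3) = c := by
  rw [sectionHom, MvPolynomial.aeval_X, show (3 : Fin 4) = Fin.last 3 from rfl, Fin.snoc_last]

theorem sectionHom_diagHom (c p : MvPolynomial (Fin 3) ℝ) : sectionHom c (diagHom p) = p := by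
  have : (sectionHom c).comp diagHom = AlgHom.id ℝ _ := by
    ext1 i
    rw [AlgHom.comp_apply, diagHom, MvPolynomial.aeval_X, map_sub, sectionHom_X_castSucc,
      sectionHom_X_last, add_sub_cancel_right, AlgHom.id_apply]
  exact DFunLike.congr_fun this p

theorem diagHom_injective : Function.Injective diagHom :=
  Function.LeftInverse.injective (sectionHom_diagHom 0)

theorem eval_diagHom (b : Fin 4 → ℝ) (p : MvPolynomial (Fin 3) ℝ) :
    MvPolynomial.eval b (diagHom p) = MvPolynomial.eval (diagProj b) p := by
  rw [diagHom, MvPolynomial.aeval_eq_bind₁, MvPolynomial.eval, MvPolynomial.eval₂Hom_bind₁]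
  congr 1
  simp only [map_sub, MvPolynomial.eval₂Hom_X']
  rfl

theorem boundedPolynomials_projStar {δ : Fin 3 → Fin 4 → ℕ} (hδ : Admissible δ) {r : ℝ}
    (hr : 0 < r) :
    boundedPolynomials (r • projStar δ) = (supportAlgebra (cone δ)).comap diagHom := by
  have hproj : ∀ b : Fin 4 → ℝ, diagProj (r • b) = r • diagProj b := fun b => by
    ext i
    simp [diagProj, mul_sub]
  ext p
  rw [← boundedPolynomials_starSet hδ hr, Subalgebra.mem_comap]
  refine exists_congr fun c => ⟨?_, ?_⟩
  · rintro h _ ⟨b, hb, rfl⟩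
    have := h _ (Set.smul_mem_smul_set (a := r) (Set.mem_image_of_mem diagProj hb))
    simpa only [eval_diagHom, hproj] using this
  · rintro h _ ⟨_, ⟨b, hb, rfl⟩, rfl⟩
    have := h _ (Set.smul_mem_smul_set (a := r) hb)
    simpa only [eval_diagHom, hproj] using this

/-! ### Laurent monomials -/

section Laurent

open MvPolynomial

/-- The Laurent monomial `x ^ v`. -/
noncomputable def laurent (v : Fin 4 → ℤ) : RatFun := ∏ j, x j ^ v j

theorem x_ne_zero (j : Fin 4) : x j ≠ 0 := by
  rw [x, Ne, FaithfulSMul.algebraMap_eq_zero_iff]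
  exact X_ne_zero j

theorem laurent_add (v w : Fin 4 → ℤ) : laurent (v + w) = laurent v * laurent w := by
  rw [laurent, laurent, laurent, ← Finset.prod_mul_distrib]
  exact Finset.prod_congr rfl fun j _ => zpow_add₀ (x_ne_zero j) _ _

theorem laurent_natCast (n : Fin 4 →₀ ℕ) :
    laurent (fun j => (n j : ℤ)) = algebraMap (MvPolynomial (Fin 4) ℝ) RatFun (monomial n 1) := by
  rw [monomial_eq, C_1, one_mul, Finsupp.prod_fintype _ _ (by simp), map_prod]
  simp only [laurent, zpow_natCast, map_pow, x]

theorem algebraMap_monomial (n : Fin 4 →₀ ℕ) (c : ℝ) :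
    algebraMap (MvPolynomial (Fin 4) ℝ) RatFun (monomial n c) =
      c • laurent (fun j => (n j : ℤ)) := by
  have h := map_smul (IsScalarTower.toAlgHom ℝ (MvPolynomial (Fin 4) ℝ) RatFun) c (monomial n 1)
  rw [smul_monomial, smul_eq_mul, mul_one] at h
  rw [laurent_natCast]
  exact h

theorem linearIndependent_laurent : LinearIndependent ℝ laurent := by
  rw [linearIndependent_iff']
  intro s g hg v hv
  obtain ⟨N, hN⟩ : ∃ N : ℕ, ∀ w ∈ s, ∀ j, 0 ≤ w j + N := by
    refine ⟨∑ w ∈ s, ∑ j, (w j).natAbs, fun w hw j => ?_⟩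
    have h1 := Finset.single_le_sum (f := fun w : Fin 4 → ℤ => ∑ j, (w j).natAbs)
      (fun _ _ => Nat.zero_le _) hw
    have h2 := Finset.single_le_sum (f := fun j => (w j).natAbs)
      (fun _ _ => Nat.zero_le _) (Finset.mem_univ j)
    omega
  let e : (Fin 4 → ℤ) → (Fin 4 →₀ ℕ) := fun w =>
    Finsupp.equivFunOnFinite.symm fun j => (w j + N).toNat
  have he : ∀ w ∈ s, (fun j => ((e w j : ℕ) : ℤ)) = w + fun _ => (N : ℤ) := fun w hw => by
    ext j
    simp [e, hN w hw j]
  have hinj : ∀ w ∈ s, e w = e v → w = v := fun w hw h => by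
    have h1 := he w hw
    rw [h, he v hv] at h1
    exact (add_right_cancel h1).symm
  have hsum : algebraMap (MvPolynomial (Fin 4) ℝ) RatFun (∑ w ∈ s, monomial (e w) (g w)) = 0 := by
    rw [map_sum, ← zero_mul (laurent fun _ => (N : ℤ)), ← hg, Finset.sum_mul]
    refine Finset.sum_congr rfl fun w hw => ?_
    rw [smul_mul_assoc, ← laurent_add, ← he w hw, algebraMap_monomial]
  rw [FaithfulSMul.algebraMap_eq_zero_iff] at hsum
  have hcoef := congrArg (coeff (e v)) hsum
  rw [coeff_sum, coeff_zero, Finset.sum_eq_single v] at hcoef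
  · simpa using hcoef
  · intro w hw hne
    rw [coeff_monomial, if_neg fun h => hne (hinj w hw h)]
  · exact fun h => absurd hv h

/-- The span of the Laurent monomials with exponents in a given set. -/
noncomputable def laurentSpan (s : Set (Fin 4 → ℤ)) : Submodule ℝ RatFun :=
  Submodule.span ℝ (laurent '' s)

theorem mul_mem_laurentSpan {s t r : Set (Fin 4 → ℤ)} (h : s + t ⊆ r) {a b : RatFun}
    (ha : a ∈ laurentSpan s) (hb : b ∈ laurentSpan t) : a * b ∈ laurentSpan r := by
  have := Submodule.mul_mem_mul ha hb
  rw [laurentSpan, laurentSpan, Submodule.span_mul_span] at this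
  refine Submodule.span_mono ?_ this
  rintro _ ⟨_, ⟨v, hv, rfl⟩, _, ⟨w, hw, rfl⟩, rfl⟩
  exact ⟨v + w, h (Set.add_mem_add hv hw), laurent_add v w⟩

theorem polyX_le_laurentSpan {z : RatFun} (hz : z ∈ polyX) :
    z ∈ laurentSpan {v | ∀ j, 0 ≤ v j} := by
  obtain ⟨p, rfl⟩ := hz
  change algebraMap (MvPolynomial (Fin 4) ℝ) RatFun p ∈ _
  rw [p.as_sum, map_sum]
  refine Submodule.sum_mem _ fun n _ => ?_
  rw [algebraMap_monomial]
  exact Submodule.smul_mem _ _ (Submodule.subset_span ⟨_, fun j => Int.natCast_nonneg _, rfl⟩)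

theorem laurent_mem_polyX {v : Fin 4 → ℤ} (hv : ∀ j, 0 ≤ v j) : laurent v ∈ polyX := by
  lift v to Fin 4 → ℕ using hv
  exact ⟨_, (laurent_natCast (Finsupp.equivFunOnFinite.symm v)).symm⟩

variable (δ : Fin 3 → Fin 4 → ℕ) (γ : ℕ)

/-- The exponent of the Laurent monomial `y_l` in the coordinates `x_j`. -/
def yRow : Fin 4 → Fin 4 → ℤ := Fin.snoc (fun i => expVec δ i) (Pi.single 3 (γ : ℤ))

/-- The exponent vector of `y ^ m` in the coordinates `x_j`, as a function of `m`. -/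
def yExp : (Fin 4 → ℤ) →+ (Fin 4 → ℤ) where
  toFun m j := ∑ l, m l * yRow δ γ l j
  map_zero' := by ext; simp
  map_add' a b := by ext; simp [add_mul, Finset.sum_add_distrib]

theorem y_eq_laurent (l : Fin 4) : y δ γ l = laurent (yRow δ γ l) := by
  induction l using Fin.lastCases with
  | last =>
    rw [y, yRow, Fin.snoc_last, Fin.snoc_last, laurent, Finset.prod_eq_single 3]
    · simp
    · intro j _ hj
      simp [hj]
    · simp
  | cast i => rw [y, yRow, Fin.snoc_castSucc, Fin.snoc_castSucc, laurent]

theorem prod_y_zpow (m : Fin 4 → ℤ) : ∏ l, y δ γ l ^ m l = laurent (yExp δ γ m) := by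
  simp only [y_eq_laurent, laurent, ← Finset.prod_zpow]
  rw [Finset.prod_comm]
  refine Finset.prod_congr rfl fun j _ => ?_
  change _ = x j ^ ∑ l, m l * yRow δ γ l j
  simp only [Fin.sum_univ_four, Fin.prod_univ_four, zpow_add₀ (x_ne_zero j), ← zpow_mul, mul_comm]

theorem prod_y_pow (n : Fin 4 → ℕ) :
    ∏ l, y δ γ l ^ n l = laurent (yExp δ γ fun l => (n l : ℤ)) := by
  rw [← prod_y_zpow]
  simp only [zpow_natCast]

theorem yExp_castSucc (n : Fin 4 →₀ ℕ) (j : Fin 3) :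
    yExp δ γ (fun l => (n l : ℤ)) j.castSucc = weight δ j n := by
  change ∑ l, (n l : ℤ) * yRow δ γ l j.castSucc = _
  rw [Fin.sum_univ_castSucc, weight]
  simp only [yRow, Fin.snoc_castSucc, Fin.snoc_last]
  rw [Pi.single_eq_of_ne (by exact (Fin.castSucc_lt_last j).ne), mul_zero, add_zero]
  exact Finset.sum_congr rfl fun l _ => mul_comm _ _

theorem yExp_last_nonneg (n : Fin 4 →₀ ℕ) : 0 ≤ yExp δ γ (fun l => (n l : ℤ)) (Fin.last 3) := by
  change 0 ≤ ∑ l, (n l : ℤ) * yRow δ γ l (Fin.last 3)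
  refine Finset.sum_nonneg fun l _ => mul_nonneg (Int.natCast_nonneg _) ?_
  induction l using Fin.lastCases with
  | last =>
    rw [yRow, Fin.snoc_last, show (3 : Fin 4) = Fin.last 3 from rfl, Pi.single_eq_same]
    exact Int.natCast_nonneg _
  | cast i =>
    rw [yRow, Fin.snoc_castSucc, expVec_of_ne δ (Fin.castSucc_lt_last i).ne']
    exact Int.natCast_nonneg _

theorem yExp_nonneg_iff (n : Fin 4 →₀ ℕ) :
    (∀ j, 0 ≤ yExp δ γ (fun l => (n l : ℤ)) j) ↔ n ∈ cone δ := by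
  rw [mem_cone, Fin.forall_fin_succ']
  simp only [yExp_castSucc, yExp_last_nonneg, and_true]

variable {δ γ}

theorem yExp_injective (hδ : Admissible δ) (hγ : 0 < γ) : Function.Injective (yExp δ γ) := by
  rw [injective_iff_map_eq_zero]
  intro m hm
  have h : ∀ j, ∑ l, m l * yRow δ γ l j = 0 := fun j => congrFun hm j
  have h0 := h 0
  have h1 := h 1
  have h2 := h 2
  have h3 := h 3
  have r0 : yRow δ γ 0 = expVec δ 0 := rfl
  have r1 : yRow δ γ 1 = expVec δ 1 := rfl
  have r2 : yRow δ γ 2 = expVec δ 2 := rfl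
  have r3 : yRow δ γ 3 = Pi.single 3 (γ : ℤ) := rfl
  simp only [Fin.sum_univ_four, r0, r1, r2, r3, expVec, Pi.single_apply] at h0 h1 h2 h3
  simp [Fin.ext_iff] at h0 h1 h2 h3
  have hdet := hδ.det_pos
  set D : ℤ := δ 0 1 * δ 1 2 * δ 2 0 + δ 0 2 * δ 1 0 * δ 2 1 +
    δ 0 0 * δ 1 2 * δ 2 1 + δ 1 1 * δ 0 2 * δ 2 0 + δ 2 2 * δ 0 1 * δ 1 0 -
    δ 0 0 * δ 1 1 * δ 2 2 with hD
  have hD0 : D ≠ 0 := by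
    have : 0 < D := by linarith
    exact this.ne'
  have e0 : m 0 = 0 := by
    have : D * m 0 = 0 := by
      rw [hD]
      linear_combination ((δ 1 1 : ℤ) * δ 2 2 - δ 1 2 * δ 2 1) * h0 +
        (-(-(δ 1 0 : ℤ) * δ 2 2 - δ 1 2 * δ 2 0)) * h1 + (δ 1 0 * δ 2 1 + δ 1 1 * δ 2 0) * h2
    exact (mul_eq_zero.1 this).resolve_left hD0
  have e1 : m 1 = 0 := by
    have : D * m 1 = 0 := by
      rw [hD]
      linear_combination ((δ 0 1 : ℤ) * δ 2 2 + δ 0 2 * δ 2 1) * h0 +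
        ((δ 0 0 : ℤ) * δ 2 2 - δ 0 2 * δ 2 0) * h1 + ((δ 0 0 : ℤ) * δ 2 1 + δ 0 1 * δ 2 0) * h2
    exact (mul_eq_zero.1 this).resolve_left hD0
  have e2 : m 2 = 0 := by
    have : D * m 2 = 0 := by
      rw [hD]
      linear_combination ((δ 0 1 : ℤ) * δ 1 2 + δ 0 2 * δ 1 1) * h0 +
        ((δ 0 0 : ℤ) * δ 1 2 + δ 0 2 * δ 1 0) * h1 + ((δ 0 0 : ℤ) * δ 1 1 - δ 0 1 * δ 1 0) * h2
    exact (mul_eq_zero.1 this).resolve_left hD0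
  have e3 : m 3 = 0 := by
    rw [e0, e1, e2] at h3
    simp at h3
    exact h3.resolve_right (by omega)
  ext l
  fin_cases l
  exacts [e0, e1, e2, e3]

end Laurent

section Laurent

open MvPolynomial

variable {δ : Fin 3 → Fin 4 → ℕ} {γ : ℕ}

/-! ### Polynomials in the elements `y` -/

theorem aeval_y (p : MvPolynomial (Fin 4) ℝ) :
    aeval (y δ γ) p = ∑ n ∈ p.support, coeff n p • laurent (yExp δ γ fun l => (n l : ℤ)) := by
  rw [aeval_def, eval₂_eq']
  refine Finset.sum_congr rfl fun n _ => ?_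
  rw [prod_y_pow, Algebra.smul_def]

/-- Distinct monomials in the `y_l` are distinct Laurent monomials, so no cancellation occurs. -/
theorem yExp_mem_of_aeval_mem (hδ : Admissible δ) (hγ : 0 < γ) {p : MvPolynomial (Fin 4) ℝ}
    {s : Set (Fin 4 → ℤ)} (h : aeval (y δ γ) p ∈ laurentSpan s) {n : Fin 4 →₀ ℕ}
    (hn : n ∈ p.support) : (yExp δ γ fun l => (n l : ℤ)) ∈ s := by
  obtain ⟨f, hf, hfz⟩ := (Finsupp.mem_span_image_iff_linearCombination ℝ).1 h
  set g : (Fin 4 → ℤ) →₀ ℝ :=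
    ∑ m ∈ p.support, Finsupp.single (yExp δ γ fun l => (m l : ℤ)) (coeff m p) with hg
  have hgz : Finsupp.linearCombination ℝ laurent g = aeval (y δ γ) p := by
    simp only [hg, map_sum, Finsupp.linearCombination_single, aeval_y]
  have hfg : f = g := linearIndependent_laurent (hfz.trans hgz.symm)
  have hval : g (yExp δ γ fun l => (n l : ℤ)) = coeff n p := by
    rw [hg, Finsupp.finsetSum_apply, Finset.sum_eq_single n]
    · simp
    · intro m _ hmn
      rw [Finsupp.single_apply, if_neg]
      intro e
      refine hmn (Finsupp.ext fun l => ?_)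
      exact_mod_cast congrFun (yExp_injective hδ hγ e) l
    · exact fun h => absurd hn h
  refine hf (Finsupp.mem_support_iff.2 ?_)
  rw [hfg, hval]
  exact mem_support_iff.1 hn

theorem algebraicIndependent_y (hδ : Admissible δ) (hγ : 0 < γ) :
    AlgebraicIndependent ℝ (y δ γ) := by
  rw [algebraicIndependent_iff]
  intro p hp
  rw [← support_eq_empty, Finset.eq_empty_iff_forall_notMem]
  intro n hn
  have h0 : aeval (y δ γ) p ∈ laurentSpan ∅ := hp ▸ Submodule.zero_mem _
  exact yExp_mem_of_aeval_mem hδ hγ h0 hn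

theorem aeval_bigPi (p : MvPolynomial (Fin 3) ℝ) :
    aeval (bigPi δ γ) p = aeval (y δ γ) (diagHom p) := by
  have : aeval (bigPi δ γ) = (aeval (y δ γ)).comp diagHom := by
    ext1 i
    rw [aeval_X, AlgHom.comp_apply, diagHom, aeval_X, map_sub, aeval_X, aeval_X, bigPi]
  rw [this, AlgHom.comp_apply]

theorem algebraicIndependent_bigPi (hδ : Admissible δ) (hγ : 0 < γ) :
    AlgebraicIndependent ℝ (bigPi δ γ) := by
  intro p q h
  rw [aeval_bigPi, aeval_bigPi] at h
  exact diagHom_injective (algebraicIndependent_y hδ hγ h)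

theorem aeval_y_mem_polyX_iff (hδ : Admissible δ) (hγ : 0 < γ) {p : MvPolynomial (Fin 4) ℝ} :
    aeval (y δ γ) p ∈ polyX ↔ p ∈ supportAlgebra (cone δ) := by
  constructor
  · intro h n hn
    exact (yExp_nonneg_iff δ γ n).1 (yExp_mem_of_aeval_mem hδ hγ (polyX_le_laurentSpan h) hn)
  · intro h
    rw [aeval_y]
    exact Subalgebra.sum_mem _ fun n hn => Subalgebra.smul_mem _
      (laurent_mem_polyX ((yExp_nonneg_iff δ γ n).2 (h n hn))) _

theorem map_supportAlgebra_cone (hδ : Admissible δ) (hγ : 0 < γ) :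
    (supportAlgebra (cone δ)).map (aeval (y δ γ)) = algT δ γ := by
  ext z
  rw [algT, Algebra.mem_inf, Algebra.adjoin_range_eq_range_aeval, Subalgebra.mem_map]
  constructor
  · rintro ⟨p, hp, rfl⟩
    exact ⟨⟨p, rfl⟩, (aeval_y_mem_polyX_iff hδ hγ).2 hp⟩
  · rintro ⟨⟨p, rfl⟩, hp⟩
    exact ⟨p, (aeval_y_mem_polyX_iff hδ hγ).1 hp, rfl⟩

theorem algT_eq_adjoin (hδ : Admissible δ) (hγ : 0 < γ) :
    algT δ γ = Algebra.adjoin ℝ (monomialsM δ γ) := by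
  apply le_antisymm
  · rw [← map_supportAlgebra_cone hδ hγ]
    rintro _ ⟨p, hp, rfl⟩
    change aeval (y δ γ) p ∈ _
    rw [aeval_y]
    refine Subalgebra.sum_mem _ fun n hn => Subalgebra.smul_mem _ (Algebra.subset_adjoin ?_) _
    exact ⟨n, mem_cone_iff.1 (hp n hn), (prod_y_pow δ γ n).symm⟩
  · rw [Algebra.adjoin_le_iff]
    rintro _ ⟨n, hn, rfl⟩
    refine Algebra.mem_inf.2 ⟨Subalgebra.prod_mem _ fun l _ => Subalgebra.pow_mem _
      (Algebra.subset_adjoin (Set.mem_range_self l)) _, ?_⟩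
    rw [prod_y_pow]
    exact laurent_mem_polyX
      ((yExp_nonneg_iff δ γ (Finsupp.equivFunOnFinite.symm n)).2 (mem_cone_iff.2 hn))

/-! ### Kuroda's algebra consists of polynomials in the `Π_i` -/

/-- A Laurent polynomial in the `x_j` that is a quotient of polynomials in the `y_l` is a Laurent
polynomial in the `y_l`: the part of it with exponents outside the lattice spanned by the exponents
of the `y_l` has to vanish. -/
theorem mem_laurentSpan_range_yExp {z q : RatFun} (hz : z ∈ laurentSpan Set.univ) (hq : q ≠ 0)
    (hqs : q ∈ laurentSpan (Set.range (yExp δ γ)))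
    (hzq : z * q ∈ laurentSpan (Set.range (yExp δ γ))) :
    z ∈ laurentSpan (Set.range (yExp δ γ)) := by
  set Λ : AddSubgroup (Fin 4 → ℤ) := (yExp δ γ).range with hΛ
  change q ∈ laurentSpan (Λ : Set (Fin 4 → ℤ)) at hqs
  change z * q ∈ laurentSpan (Λ : Set (Fin 4 → ℤ)) at hzq
  change z ∈ laurentSpan (Λ : Set (Fin 4 → ℤ))
  have hsplit : laurentSpan Set.univ =
      laurentSpan (Λ : Set (Fin 4 → ℤ)) ⊔ laurentSpan (Λ : Set (Fin 4 → ℤ))ᶜ := by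
    rw [laurentSpan, laurentSpan, laurentSpan, ← Submodule.span_union, ← Set.image_union,
      Set.union_compl_self]
  rw [hsplit] at hz
  obtain ⟨z₀, h₀, z₁, h₁, rfl⟩ := Submodule.mem_sup.1 hz
  have h₀q : z₀ * q ∈ laurentSpan (Λ : Set (Fin 4 → ℤ)) := by
    refine mul_mem_laurentSpan ?_ h₀ hqs
    rintro _ ⟨v, hv, w, hw, rfl⟩
    exact Λ.add_mem hv hw
  have h₁q : z₁ * q ∈ laurentSpan (Λ : Set (Fin 4 → ℤ))ᶜ := by
    refine mul_mem_laurentSpan ?_ h₁ hqs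
    rintro _ ⟨v, hv, w, hw, rfl⟩
    exact fun h => hv ((Λ.add_mem_cancel_right hw).1 h)
  have h₁q' : z₁ * q ∈ laurentSpan (Λ : Set (Fin 4 → ℤ)) := by
    have := Submodule.sub_mem _ hzq h₀q
    rwa [add_mul, add_sub_cancel_left] at this
  have hdisj := linearIndependent_laurent.disjoint_span_image
    (disjoint_compl_right (a := (Λ : Set (Fin 4 → ℤ))))
  have hzero : z₁ * q = 0 := Submodule.disjoint_def.1 hdisj _ h₁q' h₁q
  rw [(mul_eq_zero.1 hzero).resolve_right hq, add_zero]
  exact h₀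

theorem aeval_y_mem_laurentSpan (p : MvPolynomial (Fin 4) ℝ) :
    aeval (y δ γ) p ∈ laurentSpan (Set.range (yExp δ γ)) := by
  rw [aeval_y]
  exact Submodule.sum_mem _ fun n _ => Submodule.smul_mem _ _
    (Submodule.subset_span ⟨_, ⟨_, rfl⟩, rfl⟩)

theorem exists_mul_prod_pow_eq_aeval {z : RatFun}
    (hz : z ∈ laurentSpan (Set.range (yExp δ γ))) :
    ∃ (N : ℕ) (g : MvPolynomial (Fin 4) ℝ),
      z * aeval (y δ γ) ((∏ l, (X l : MvPolynomial (Fin 4) ℝ)) ^ N) = aeval (y δ γ) g := by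
  induction hz using Submodule.span_induction with
  | zero => exact ⟨0, 0, by simp⟩
  | add z w _ _ hz hw =>
    obtain ⟨N, g, hg⟩ := hz
    obtain ⟨M, h, hh⟩ := hw
    refine ⟨N + M, g * (∏ l, X l) ^ M + h * (∏ l, X l) ^ N, ?_⟩
    rw [map_add, map_mul, map_mul, ← hg, ← hh, pow_add, map_mul]
    ring
  | smul c z _ hz =>
    obtain ⟨N, g, hg⟩ := hz
    exact ⟨N, c • g, by rw [map_smul, ← hg, smul_mul_assoc]⟩
  | mem z hz =>
    obtain ⟨_, ⟨m, rfl⟩, rfl⟩ := hz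
    obtain ⟨N, hN⟩ : ∃ N : ℕ, ∀ l, 0 ≤ m l + N := by
      refine ⟨∑ l, (m l).natAbs, fun l => ?_⟩
      have := Finset.single_le_sum (f := fun l => (m l).natAbs)
        (fun _ _ => Nat.zero_le _) (Finset.mem_univ l)
      omega
    refine ⟨N, ∏ l, X l ^ (m l + N).toNat, ?_⟩
    rw [← Finset.prod_pow, map_prod, map_prod, ← prod_y_zpow, ← Finset.prod_mul_distrib]
    refine Finset.prod_congr rfl fun l _ => ?_
    have hy : y δ γ l ≠ 0 := by
      rw [y_eq_laurent]
      exact linearIndependent_laurent.ne_zero _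
    rw [map_pow, map_pow, aeval_X, ← zpow_natCast, ← zpow_natCast, ← zpow_add₀ hy,
      Int.toNat_of_nonneg (hN l)]

/-- A nonzero polynomial that is invariant under diagonal translations is not divisible by any of
the variables: the hyperplane `b_l = 0` is the graph of a section of the projection. -/
theorem isRelPrime_diagHom_X {q : MvPolynomial (Fin 3) ℝ} (hq : q ≠ 0) (l : Fin 4) :
    IsRelPrime (diagHom q) (X l) := by
  refine ((X_prime.irreducible.isRelPrime_iff_not_dvd).2 ?_).symm
  rintro ⟨h, hh⟩
  have key : ∀ c : MvPolynomial (Fin 3) ℝ, sectionHom c (X l) ≠ 0 := by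
    intro c hc
    have := congrArg (sectionHom c) hh
    rw [map_mul, hc, zero_mul, sectionHom_diagHom] at this
    exact hq this
  induction l using Fin.lastCases with
  | last => exact key 0 (sectionHom_X_last 0)
  | cast i => exact key (-X i) (by rw [sectionHom_X_castSucc, add_neg_cancel])

theorem mem_range_aeval_bigPi (hδ : Admissible δ) (hγ : 0 < γ) {z : RatFun} (hz : z ∈ algR δ γ) :
    ∃ p : MvPolynomial (Fin 3) ℝ, aeval (bigPi δ γ) p = z := by
  obtain ⟨hzX, hzF⟩ := hz
  obtain ⟨p, q, hpq⟩ := (IntermediateField.mem_adjoin_range_iff _ _ _).1 hzF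
  rcases eq_or_ne q 0 with rfl | hq
  · exact ⟨0, by rw [map_zero, hpq, map_zero, div_zero]⟩
  have hq' : aeval (bigPi δ γ) q ≠ 0 := fun h =>
    hq (algebraicIndependent_bigPi hδ hγ (h.trans (map_zero _).symm))
  have hzq : z * aeval (y δ γ) (diagHom q) = aeval (y δ γ) (diagHom p) := by
    rw [← aeval_bigPi, ← aeval_bigPi, hpq, div_mul_cancel₀ _ hq']
  have hzΛ : z ∈ laurentSpan (Set.range (yExp δ γ)) := by
    refine mem_laurentSpan_range_yExp (q := aeval (y δ γ) (diagHom q)) ?_ ?_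
      (aeval_y_mem_laurentSpan _) ?_
    · exact Submodule.span_mono (Set.image_mono (Set.subset_univ _)) (polyX_le_laurentSpan hzX)
    · rwa [← aeval_bigPi]
    · rw [hzq]
      exact aeval_y_mem_laurentSpan _
  obtain ⟨N, g, hg⟩ := exists_mul_prod_pow_eq_aeval hzΛ
  have hdvd : diagHom q ∣ diagHom p * (∏ l, X l) ^ N := by
    refine ⟨g, algebraicIndependent_y hδ hγ ?_⟩
    rw [map_mul, map_mul, ← hg, ← hzq]
    ring
  have hrel : IsRelPrime (diagHom q) ((∏ l, X l) ^ N) :=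
    IsRelPrime.pow_right (IsRelPrime.prod_right fun l _ => isRelPrime_diagHom_X hq l)
  obtain ⟨w, hw⟩ := hrel.dvd_of_dvd_mul_right hdvd
  have hpw := congrArg (sectionHom 0) hw
  rw [map_mul, sectionHom_diagHom, sectionHom_diagHom] at hpw
  refine ⟨sectionHom 0 w, ?_⟩
  rw [hpq, hpw, map_mul, mul_div_cancel_left₀ _ hq']

theorem map_comap_supportAlgebra_cone (hδ : Admissible δ) (hγ : 0 < γ) :
    ((supportAlgebra (cone δ)).comap diagHom).map (aeval (bigPi δ γ)) = algR δ γ := by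
  ext z
  constructor
  · rintro ⟨p, hp, rfl⟩
    change aeval (bigPi δ γ) p ∈ _
    refine ⟨?_, (IntermediateField.mem_adjoin_range_iff _ _ _).2 ⟨p, 1, by simp⟩⟩
    change _ ∈ polyX
    rw [aeval_bigPi]
    exact (aeval_y_mem_polyX_iff hδ hγ).2 hp
  · intro hz
    obtain ⟨p, rfl⟩ := mem_range_aeval_bigPi hδ hγ hz
    refine ⟨p, ?_, rfl⟩
    have hz' : aeval (bigPi δ γ) p ∈ polyX := hz.1
    rw [aeval_bigPi] at hz'
    exact (aeval_y_mem_polyX_iff hδ hγ).1 hz'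

end Laurent

/-! ### Multiplication of a sequence by an exponential -/

section ExpShift

variable {A : Type*} [CommRing A] [Algebra ℚ A]

/-- The coefficients of the power series `exp (U z) * ∑ h k z ^ k`. -/
noncomputable def expShift (U : A) (h : ℕ → A) (k : ℕ) : A :=
  PowerSeries.coeff k (PowerSeries.rescale U (PowerSeries.exp A) * PowerSeries.mk h)

theorem expShift_eq_sum (U : A) (h : ℕ → A) (k : ℕ) :
    expShift U h k = ∑ a ∈ Finset.HasAntidiagonal.antidiagonal k,
      U ^ a.1 * algebraMap ℚ A (1 / a.1.factorial) * h a.2 := by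
  rw [expShift, PowerSeries.coeff_mul]
  simp only [PowerSeries.coeff_rescale, PowerSeries.coeff_exp, PowerSeries.coeff_mk]

theorem expShift_add (U V : A) (h : ℕ → A) :
    expShift (U + V) h = expShift V (expShift U h) := by
  have : PowerSeries.mk (expShift U h) =
      PowerSeries.rescale U (PowerSeries.exp A) * PowerSeries.mk h := by
    ext k
    rw [PowerSeries.coeff_mk, expShift]
  ext k
  rw [expShift, expShift, this, ← mul_assoc, PowerSeries.exp_mul_exp_eq_exp_add, add_comm]

theorem expShift_zero_right (U : A) (h : ℕ → A) : expShift U h 0 = h 0 := by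
  simp [expShift_eq_sum]

/-- The terms of `expShift U h (k + 1)` other than `h (k + 1)`. -/
theorem expShift_succ (U : A) (h : ℕ → A) (k : ℕ) :
    expShift U h (k + 1) = h (k + 1) + ∑ a ∈ Finset.HasAntidiagonal.antidiagonal k,
      U ^ (a.1 + 1) * algebraMap ℚ A (1 / (a.1 + 1).factorial) * h a.2 := by
  rw [expShift_eq_sum, Finset.Nat.sum_antidiagonal_succ]
  simp

theorem snd_le_of_mem_antidiagonal {k : ℕ} {a : ℕ × ℕ}
    (ha : a ∈ Finset.HasAntidiagonal.antidiagonal k) : a.2 ≤ k := by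
  have := Finset.HasAntidiagonal.mem_antidiagonal.1 ha
  omega

theorem expShift_congr (U : A) {h h' : ℕ → A} {k : ℕ} (H : ∀ j ≤ k, h j = h' j) :
    expShift U h k = expShift U h' k := by
  rw [expShift_eq_sum, expShift_eq_sum]
  refine Finset.sum_congr rfl fun a ha => ?_
  rw [H _ (snd_le_of_mem_antidiagonal ha)]

theorem map_expShift {B : Type*} [CommRing B] [Algebra ℚ B] (φ : A →+* B) (U : A) (h : ℕ → A)
    (k : ℕ) : φ (expShift U h k) = expShift (φ U) (fun j => φ (h j)) k := by
  rw [expShift_eq_sum, expShift_eq_sum, map_sum]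
  refine Finset.sum_congr rfl fun a _ => ?_
  rw [map_mul, map_mul, map_pow, ← RingHom.comp_apply, Subsingleton.elim
    (φ.comp (algebraMap ℚ A)) (algebraMap ℚ B)]

end ExpShift

/-! ### A sequence of univariate polynomials -/

section Univariate

open Polynomial in
/-- Hermite interpolation: a polynomial with prescribed orders of vanishing at `0` and, after
adding a given polynomial, at `1`. -/
theorem exists_interpolation (a b : ℕ) (r : Polynomial ℝ) :
    ∃ η : Polynomial ℝ, η.natDegree ≤ a + b ∧ X ^ a ∣ η ∧ (X - 1) ^ b ∣ η + r := by
  have hcop : IsCoprime ((X : Polynomial ℝ) ^ a) ((X - 1) ^ b) := by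
    refine IsCoprime.pow ⟨1, -1, ?_⟩
    ring
  obtain ⟨u, v, huv⟩ := hcop
  have hm : ((X - 1 : Polynomial ℝ) ^ b).Monic := by
    rw [← C_1]
    exact (monic_X_sub_C 1).pow b
  have hdeg : ((X - 1 : Polynomial ℝ) ^ b).natDegree = b := by
    rw [← C_1, natDegree_pow, natDegree_X_sub_C, mul_one]
  refine ⟨X ^ a * ((-r * u) %ₘ (X - 1) ^ b), ?_, dvd_mul_right _ _, ?_⟩
  · refine natDegree_mul_le.trans ?_
    rw [natDegree_X_pow]
    have := natDegree_modByMonic_le (-r * u) hm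
    omega
  · rw [modByMonic_eq_sub_mul_div]
    refine ⟨r * v - X ^ a * ((-r * u) /ₘ (X - 1) ^ b), ?_⟩
    linear_combination (-r) * huv

open Polynomial in
/-- For codegrees `c 0 + c 1 + c 2` that are at most the degree, there are arbitrarily long
sequences of polynomials of bounded degree and prescribed vanishing at `0`, whose product with
`exp (-z)` has prescribed vanishing at `1`. -/
theorem exists_polynomial_sequence {c : Fin 3 → ℕ → ℕ} {e : ℕ}
    (hc : ∀ d, e ≤ d → c 0 d + c 1 d + c 2 d ≤ d) (K : ℕ) :
    ∃ η : ℕ → Polynomial ℝ, η 0 ≠ 0 ∧ ∀ k ≤ K,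
      (η k).natDegree ≤ e + k - c 2 (e + k) ∧ X ^ c 0 (e + k) ∣ η k ∧
        (X - 1) ^ c 1 (e + k) ∣ expShift (-1) η k := by
  induction K with
  | zero =>
    refine ⟨fun _ => X ^ c 0 e * (X - 1) ^ c 1 e, ?_, fun k hk => ?_⟩
    · refine mul_ne_zero (pow_ne_zero _ X_ne_zero) (pow_ne_zero _ ?_)
      rw [← C_1]
      exact X_sub_C_ne_zero 1
    · obtain rfl : k = 0 := by omega
      rw [expShift_zero_right]
      refine ⟨?_, dvd_mul_right _ _, dvd_mul_left _ _⟩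
      refine natDegree_mul_le.trans ?_
      rw [← C_1, natDegree_X_pow, natDegree_pow, natDegree_X_sub_C]
      have := hc e le_rfl
      simp only [add_zero]
      omega
  | succ K ih =>
    obtain ⟨η, h0, h⟩ := ih
    set r : Polynomial ℝ := ∑ a ∈ Finset.HasAntidiagonal.antidiagonal K,
      (-1) ^ (a.1 + 1) * algebraMap ℚ (Polynomial ℝ) (1 / (a.1 + 1).factorial) * η a.2 with hr
    obtain ⟨θ, t1, t2, t3⟩ := exists_interpolation (c 0 (e + (K + 1))) (c 1 (e + (K + 1))) r
    have hlow : ∀ k ≤ K, Function.update η (K + 1) θ k = η k := fun k hk =>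
      Function.update_of_ne (by omega) _ _
    refine ⟨Function.update η (K + 1) θ, by rwa [hlow 0 (Nat.zero_le _)], fun k hk => ?_⟩
    rcases hk.lt_or_eq with hk | rfl
    · have hk' : k ≤ K := by omega
      rw [hlow k hk', expShift_congr (-1) (fun j hj => hlow j (hj.trans hk'))]
      exact h k hk'
    · have hexp : expShift (-1) (Function.update η (K + 1) θ) (K + 1) = θ + r := by
        rw [expShift_succ, Function.update_self, hr]
        congr 1
        refine Finset.sum_congr rfl fun a ha => ?_
        rw [hlow _ (snd_le_of_mem_antidiagonal ha)]
      rw [hexp, Function.update_self]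
      refine ⟨t1.trans ?_, t2, t3⟩
      have := hc (e + (K + 1)) (by omega)
      omega

end Univariate

/-! ### Binary forms in the differences of the coordinates -/

section BinaryForm

open MvPolynomial

variable {A : Type*} [CommRing A] [Algebra ℝ A]

/-- The binary form of degree `d` in `S`, `T` whose dehomogenization at `S = 1` is `η`. -/
noncomputable def binaryForm (S T : A) (d : ℕ) (η : Polynomial ℝ) : A :=
  aeval ![T, S] (η.homogenize d)

theorem binaryForm_mul (S T : A) {a b : ℕ} {η μ : Polynomial ℝ} (hη : η.natDegree ≤ a)
    (hμ : μ.natDegree ≤ b) :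
    binaryForm S T (a + b) (η * μ) = binaryForm S T a η * binaryForm S T b μ := by
  rw [binaryForm, Polynomial.homogenize_mul _ _ hη hμ, map_mul, binaryForm, binaryForm]

theorem map_binaryForm {B : Type*} [CommRing B] [Algebra ℝ B] (φ : A →ₐ[ℝ] B) (S T : A) (d : ℕ)
    (η : Polynomial ℝ) : φ (binaryForm S T d η) = binaryForm (φ S) (φ T) d η := by
  rw [binaryForm, binaryForm, ← AlgHom.comp_apply, comp_aeval]
  congr 2
  ext i
  fin_cases i <;> rfl

theorem binaryForm_one (S T : A) (d : ℕ) : binaryForm S T d 1 = S ^ d := by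
  simp [binaryForm]

theorem binaryForm_C_mul (S T : A) (d : ℕ) (r : ℝ) (η : Polynomial ℝ) :
    binaryForm S T d (Polynomial.C r * η) = algebraMap ℝ A r * binaryForm S T d η := by
  rw [binaryForm, Polynomial.homogenize_C_mul, map_mul, ← MvPolynomial.algebraMap_eq,
    AlgHom.commutes, binaryForm]

theorem binaryForm_X (S T : A) : binaryForm S T 1 Polynomial.X = T := by
  simp [binaryForm]

theorem binaryForm_X_sub_one (S T : A) : binaryForm S T 1 (Polynomial.X - 1) = T - S := by
  have h := Polynomial.homogenize_add (Polynomial.X - 1 : Polynomial ℝ) 1 1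
  rw [sub_add_cancel] at h
  have h' := congrArg (aeval ![T, S]) h
  rw [map_add] at h'
  change binaryForm S T 1 Polynomial.X = binaryForm S T 1 _ + binaryForm S T 1 1 at h'
  rw [binaryForm_X, binaryForm_one, pow_one] at h'
  exact eq_sub_of_add_eq h'.symm

theorem binaryForm_pow (S T : A) {η : Polynomial ℝ} (hη : η.natDegree ≤ 1) (a : ℕ) :
    binaryForm S T a (η ^ a) = binaryForm S T 1 η ^ a := by
  induction a with
  | zero => rw [pow_zero, pow_zero, binaryForm_one, pow_zero]
  | succ a ih =>
    rw [pow_succ, pow_succ, binaryForm_mul S T _ hη, ih]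
    exact (Polynomial.natDegree_pow_le).trans (by nlinarith)

theorem binaryForm_pow_mul (S T : A) {η μ : Polynomial ℝ} (hη : η.natDegree ≤ 1) {a d : ℕ}
    (had : a ≤ d) (hμ : μ.natDegree ≤ d - a) :
    binaryForm S T d (η ^ a * μ) = binaryForm S T 1 η ^ a * binaryForm S T (d - a) μ := by
  conv_lhs => rw [← Nat.add_sub_of_le had]
  rw [binaryForm_mul S T _ hμ, binaryForm_pow S T hη]
  exact (Polynomial.natDegree_pow_le).trans (by nlinarith)

/-- The form attached to `exp (-z) η` is obtained from the forms attached to `η` by multiplication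
with `exp (-S z)`. -/
theorem expShift_binaryForm [Algebra ℚ A] (S T : A) (e : ℕ) {η : ℕ → Polynomial ℝ} {k : ℕ}
    (hη : ∀ j ≤ k, (η j).natDegree ≤ e + j) :
    expShift (-S) (fun j => binaryForm S T (e + j) (η j)) k =
      binaryForm S T (e + k) (expShift (-1) η k) := by
  have hlin : ∀ (s : Finset (ℕ × ℕ)) (f : ℕ × ℕ → Polynomial ℝ),
      binaryForm S T (e + k) (∑ a ∈ s, f a) = ∑ a ∈ s, binaryForm S T (e + k) (f a) := by
    intro s f
    simp only [binaryForm, Polynomial.homogenize_finsetSum, map_sum]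
  rw [expShift_eq_sum, expShift_eq_sum, hlin]
  refine Finset.sum_congr rfl fun a ha => ?_
  have hak : e + k = a.1 + (e + a.2) := by
    rw [← Finset.HasAntidiagonal.mem_antidiagonal.1 ha]
    ring
  have hconst : algebraMap ℚ (Polynomial ℝ) (1 / a.1.factorial) =
      Polynomial.C (1 / (a.1.factorial : ℝ)) := by
    rw [Subsingleton.elim (algebraMap ℚ (Polynomial ℝ)) (Polynomial.C.comp (algebraMap ℚ ℝ)),
      RingHom.comp_apply]
    simp
  have hconst' : algebraMap ℚ A (1 / a.1.factorial) =
      algebraMap ℝ A (1 / (a.1.factorial : ℝ)) := by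
    rw [Subsingleton.elim (algebraMap ℚ A) ((algebraMap ℝ A).comp (algebraMap ℚ ℝ)),
      RingHom.comp_apply]
    simp
  have hsplit : (-1 : Polynomial ℝ) ^ a.1 * Polynomial.C (1 / (a.1.factorial : ℝ)) * η a.2 =
      Polynomial.C ((-1) ^ a.1 * (1 / (a.1.factorial : ℝ))) * (1 * η a.2) := by
    simp
  rw [hconst, hconst', hsplit, binaryForm_C_mul, hak,
    binaryForm_mul S T (by simp) (hη _ (snd_le_of_mem_antidiagonal ha)), binaryForm_one,
    neg_pow, map_mul, map_pow, map_neg, map_one]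
  ring

end BinaryForm

section Invariants

open MvPolynomial

/-! ### Invariant polynomials of high degree in the last variable -/

section Degrees

variable {σ : Type*}

theorem algebraMap_rat_eq_C (r : ℚ) :
    algebraMap ℚ (MvPolynomial σ ℝ) r = C (algebraMap ℚ ℝ r) :=
  MvPolynomial.algebraMap_apply r

theorem isHomogeneous_expShift {V : MvPolynomial σ ℝ} {h : ℕ → MvPolynomial σ ℝ} {e k : ℕ}
    (hV : V.IsHomogeneous 1) (hh : ∀ j ≤ k, (h j).IsHomogeneous (e + j)) :
    (expShift V h k).IsHomogeneous (e + k) := by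
  rw [expShift_eq_sum]
  refine IsHomogeneous.sum _ _ _ fun a ha => ?_
  have hak : e + k = 1 * a.1 + 0 + (e + a.2) := by
    have := Finset.HasAntidiagonal.mem_antidiagonal.1 ha
    omega
  rw [hak, algebraMap_rat_eq_C]
  exact ((hV.pow a.1).mul (isHomogeneous_C _ _)).mul (hh _ (snd_le_of_mem_antidiagonal ha))

theorem degreeOf_expShift_le {i : σ} {V : MvPolynomial σ ℝ} {h : ℕ → MvPolynomial σ ℝ} {k D : ℕ}
    (hV : V.degreeOf i = 0) (hh : ∀ j ≤ k, (h j).degreeOf i ≤ D) :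
    (expShift V h k).degreeOf i ≤ D := by
  rw [expShift_eq_sum]
  refine (degreeOf_sum_le i _ _).trans (Finset.sup_le fun a ha => ?_)
  refine (degreeOf_mul_le i _ _).trans ?_
  have h1 : (V ^ a.1 * algebraMap ℚ (MvPolynomial σ ℝ) (1 / a.1.factorial)).degreeOf i = 0 := by
    rw [algebraMap_rat_eq_C, ← Nat.le_zero]
    refine (degreeOf_mul_C_le _ _ _).trans ((degreeOf_pow_le _ _ _).trans ?_)
    rw [hV, mul_zero]
  rw [h1, zero_add]
  exact hh _ (snd_le_of_mem_antidiagonal ha)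

variable {S T : MvPolynomial σ ℝ}

theorem isHomogeneous_binaryForm (hS : S.IsHomogeneous 1) (hT : T.IsHomogeneous 1) (d : ℕ)
    (η : Polynomial ℝ) : (binaryForm S T d η).IsHomogeneous d := by
  have := (Polynomial.isHomogeneous_homogenize (n := d) η).aeval ![T, S] (n := 1) fun i => by
    fin_cases i
    exacts [hT, hS]
  rwa [one_mul] at this

/-- Divisibility by a power of a linear form without the `i`-th variable bounds the degree in that
variable. -/
theorem degreeOf_binaryForm_pow_mul_le (hS : S.IsHomogeneous 1) (hT : T.IsHomogeneous 1) {i : σ}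
    {ν μ : Polynomial ℝ} (hν : ν.natDegree ≤ 1) (hi : (binaryForm S T 1 ν).degreeOf i = 0)
    {a d : ℕ} (had : a ≤ d) (hμ : μ.natDegree ≤ d - a) :
    (binaryForm S T d (ν ^ a * μ)).degreeOf i ≤ d - a := by
  rw [binaryForm_pow_mul S T hν had hμ]
  refine (degreeOf_mul_le i _ _).trans ?_
  have h1 : (binaryForm S T 1 ν ^ a).degreeOf i ≤ 0 := by
    refine (degreeOf_pow_le _ _ _).trans ?_
    rw [hi, mul_zero]
  have h2 : (binaryForm S T (d - a) μ).degreeOf i ≤ d - a :=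
    (degreeOf_le_totalDegree _ _).trans (isHomogeneous_binaryForm hS hT _ _).totalDegree_le
  omega

theorem degreeOf_binaryForm_le_of_dvd (hS : S.IsHomogeneous 1) (hT : T.IsHomogeneous 1) {i : σ}
    {ν η : Polynomial ℝ} (hν : ν.natDegree = 1) (hmon : ν.Monic)
    (hi : (binaryForm S T 1 ν).degreeOf i = 0)
    {a d : ℕ} (had : a ≤ d) (hη : η.natDegree ≤ d) (hdvd : ν ^ a ∣ η) :
    (binaryForm S T d η).degreeOf i ≤ d - a := by
  obtain ⟨μ, rfl⟩ := hdvd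
  refine degreeOf_binaryForm_pow_mul_le hS hT hν.le hi had ?_
  rcases eq_or_ne μ 0 with rfl | hμ
  · simp
  · rw [(hmon.pow a).natDegree_mul' hμ, hmon.natDegree_pow, hν, mul_one] at hη
    omega

theorem degreeOf_X_sub_X_eq_zero {i a b : σ} (ha : i ≠ a) (hb : i ≠ b) :
    (X a - X b : MvPolynomial σ ℝ).degreeOf i = 0 := by
  have h : (X a - X b : MvPolynomial σ ℝ) = X a + C (-1) * X b := by
    rw [C_neg, C_1, neg_one_mul, sub_eq_add_neg]
  rw [← Nat.le_zero, h]
  refine (degreeOf_add_le _ _ _).trans (max_le ?_ ?_)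
  · rw [degreeOf_X_of_ne ha]
  · exact (degreeOf_C_mul_le _ _ _).trans (by rw [degreeOf_X_of_ne hb])

theorem degreeOf_aeval_eq_zero {τ : Type*} {i : σ} {g : τ → MvPolynomial σ ℝ}
    (hg : ∀ t, (g t).degreeOf i = 0) (f : MvPolynomial τ ℝ) : (aeval g f).degreeOf i = 0 := by
  induction f using MvPolynomial.induction_on with
  | C r => rw [← MvPolynomial.algebraMap_eq, AlgHom.commutes, MvPolynomial.algebraMap_eq,
      degreeOf_C]
  | add p q hp hq =>
    rw [map_add, ← Nat.le_zero]
    exact (degreeOf_add_le _ _ _).trans (max_le hp.le hq.le)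
  | mul_X p t hp =>
    rw [map_mul, aeval_X, ← Nat.le_zero]
    refine (degreeOf_mul_le _ _ _).trans ?_
    rw [hp, hg]

end Degrees

theorem sub_le_sub_of_step {c : ℕ → ℕ} (hc : ∀ d, c (d + 1) ≤ c d + 1) {a b : ℕ} (hab : a ≤ b) :
    a - c a ≤ b - c b := by
  induction b, hab using Nat.le_induction with
  | base => exact le_rfl
  | succ b _ ih =>
    have := hc b
    omega

/-- Given codegrees `c i d` whose sum does not exceed the degree `d`, such that the bound
`d - c i d` for the exponents of the `i`-th variable forces exponents of degree `d` into the cone,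
there are invariant polynomials with support in the cone that contain the product of `y₄ ^ K` and a
monomial of bounded degree in `y₁, y₂, y₃`. -/
theorem exists_invariant {δ : Fin 3 → Fin 4 → ℕ} {c : Fin 3 → ℕ → ℕ} {e : ℕ}
    (hstep : ∀ i d, c i (d + 1) ≤ c i d + 1)
    (hsum : ∀ d, e ≤ d → c 0 d + c 1 d + c 2 d ≤ d)
    (hcone : ∀ (d : ℕ) (n : Fin 4 →₀ ℕ), e ≤ d → n 0 + n 1 + n 2 = d →
      (∀ i : Fin 3, n i.castSucc ≤ d - c i d) → n ∈ cone δ) (K : ℕ) :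
    ∃ p : MvPolynomial (Fin 3) ℝ, diagHom p ∈ supportAlgebra (cone δ) ∧
      ∃ n ∈ (diagHom p).support, n 3 = K ∧ n 0 + n 1 + n 2 = e := by
  obtain ⟨η, hη0, hη⟩ := exists_polynomial_sequence hsum K
  set S : MvPolynomial (Fin 4) ℝ := X 0 - X 1 with hS
  set T : MvPolynomial (Fin 4) ℝ := X 2 - X 1 with hT
  have homS : S.IsHomogeneous 1 := (isHomogeneous_X ℝ 0).sub (isHomogeneous_X ℝ 1)
  have homT : T.IsHomogeneous 1 := (isHomogeneous_X ℝ 2).sub (isHomogeneous_X ℝ 1)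
  have hηd : ∀ j ≤ K, (η j).natDegree ≤ e + j := fun j hj =>
    (hη j hj).1.trans (Nat.sub_le _ _)
  set h : ℕ → MvPolynomial (Fin 4) ℝ := fun j => binaryForm S T (e + j) (η j) with hh
  set q : ℕ → MvPolynomial (Fin 4) ℝ := expShift (X 1) h with hq
  set p : MvPolynomial (Fin 3) ℝ :=
    expShift (X 1) (fun j => binaryForm (X 0 - X 1) (X 2 - X 1) (e + j) (η j)) K with hp
  have hpq : diagHom p = expShift (-X 3) q K := by
    have hX : ∀ i : Fin 3, diagHom (X i) = X i.castSucc - X 3 := fun i => by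
      rw [diagHom, aeval_X]
    have e0 : diagHom (X 0) = X 0 - X 3 := hX 0
    have e1 : diagHom (X 1) = X 1 - X 3 := hX 1
    have e2 : diagHom (X 2) = X 2 - X 3 := hX 2
    have hm := map_expShift (diagHom : MvPolynomial (Fin 3) ℝ →+* MvPolynomial (Fin 4) ℝ) (X 1)
      (fun j => binaryForm (X 0 - X 1) (X 2 - X 1) (e + j) (η j)) K
    simp only [RingHom.coe_coe, map_binaryForm, map_sub, e0, e1, e2,
      sub_sub_sub_cancel_right] at hm
    rw [hp, hm, sub_eq_add_neg, expShift_add]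
  -- Homogeneity and degrees of the `q k`; the degree in `X 1` is visible after rewriting `q` as
  -- an exponential shift by `X 0`.
  have homq : ∀ k, (q k).IsHomogeneous (e + k) := fun k =>
    isHomogeneous_expShift (isHomogeneous_X ℝ 1) fun j _ =>
      isHomogeneous_binaryForm homS homT _ _
  have hle : ∀ i : Fin 3, ∀ j, c i (e + j) ≤ e + j := fun i j => by
    have := hsum (e + j) (by omega)
    fin_cases i <;> simp only [Fin.zero_eta, Fin.mk_one, Fin.reduceFinMk] <;> omega
  have hmono : ∀ i : Fin 3, ∀ j k, j ≤ k → e + j - c i (e + j) ≤ e + k - c i (e + k) :=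
    fun i j k hjk => sub_le_sub_of_step (hstep i) (by omega)
  have deg3 : ∀ k, (q k).degreeOf 3 = 0 := by
    intro k
    refine Nat.le_zero.1 (degreeOf_expShift_le (degreeOf_X_of_ne (by decide)) fun j _ => ?_)
    refine (degreeOf_aeval_eq_zero (fun t => ?_) _).le
    fin_cases t
    exacts [degreeOf_X_sub_X_eq_zero (by decide) (by decide),
      degreeOf_X_sub_X_eq_zero (by decide) (by decide)]
  have deg0 : ∀ k ≤ K, (q k).degreeOf 0 ≤ e + k - c 0 (e + k) := by
    intro k hk
    refine degreeOf_expShift_le (degreeOf_X_of_ne (by decide)) fun j hj => ?_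
    refine le_trans ?_ (hmono 0 j k hj)
    refine degreeOf_binaryForm_le_of_dvd homS homT Polynomial.natDegree_X Polynomial.monic_X ?_
      (hle 0 j) (hηd j (hj.trans hk)) (hη j (hj.trans hk)).2.1
    rw [binaryForm_X]
    exact degreeOf_X_sub_X_eq_zero (by decide) (by decide)
  have deg2 : ∀ k ≤ K, (q k).degreeOf 2 ≤ e + k - c 2 (e + k) := by
    intro k hk
    refine degreeOf_expShift_le (degreeOf_X_of_ne (by decide)) fun j hj => ?_
    refine le_trans ?_ (hmono 2 j k hj)
    have := degreeOf_binaryForm_pow_mul_le (ν := 1) (μ := η j) (i := 2) homS homT (by simp) ?_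
      (hle 2 j) (hη j (hj.trans hk)).1
    · rwa [one_pow, one_mul] at this
    · rw [binaryForm_one, pow_one]
      exact degreeOf_X_sub_X_eq_zero (by decide) (by decide)
  have deg1 : ∀ k ≤ K, (q k).degreeOf 1 ≤ e + k - c 1 (e + k) := by
    intro k hk
    have hq' : q = expShift (X 0) (expShift (-S) h) := by
      rw [hq, ← expShift_add, hS, neg_sub, sub_add_cancel]
    rw [hq']
    refine degreeOf_expShift_le (degreeOf_X_of_ne (by decide)) fun j hj => ?_
    refine le_trans ?_ (hmono 1 j k hj)
    rw [hh, expShift_binaryForm S T e fun l hl => hηd l (hl.trans (hj.trans hk))]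
    refine degreeOf_binaryForm_le_of_dvd homS homT (Polynomial.natDegree_X_sub_C 1)
      (Polynomial.monic_X_sub_C 1) ?_ (hle 1 j) ?_ (hη j (hj.trans hk)).2.2
    · rw [Polynomial.C_1, binaryForm_X_sub_one, hT, hS, sub_sub_sub_cancel_right]
      exact degreeOf_X_sub_X_eq_zero (by decide) (by decide)
    · rw [expShift_eq_sum]
      refine Polynomial.natDegree_sum_le_of_forall_le _ _ fun a ha => ?_
      have hc0 : ((-1) ^ a.1 * algebraMap ℚ (Polynomial ℝ) (1 / a.1.factorial)).natDegree = 0 := by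
        rw [IsScalarTower.algebraMap_apply ℚ ℝ (Polynomial ℝ), Polynomial.algebraMap_eq,
          ← Polynomial.C_1, ← Polynomial.C_neg, ← Polynomial.C_pow, ← Polynomial.C_mul,
          Polynomial.natDegree_C]
      refine Polynomial.natDegree_mul_le.trans ?_
      have h1 := snd_le_of_mem_antidiagonal ha
      have h2 := hηd a.2 (by omega)
      omega
  have hdegree : ∀ k, ∀ n ∈ (q k).support, n 3 = 0 ∧ n 0 + n 1 + n 2 = e + k := by
    intro k n hn
    have h3 : n 3 = 0 := by
      have := monomial_le_degreeOf 3 hn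
      rw [deg3 k] at this
      omega
    refine ⟨h3, ?_⟩
    have hd : n.degree = e + k := by
      by_contra hne
      exact mem_support_iff.1 hn ((homq k).coeff_eq_zero hne)
    rw [Finsupp.degree_eq_sum, Fin.sum_univ_four, h3, add_zero] at hd
    exact hd
  have hqcone : ∀ k ≤ K, q k ∈ supportAlgebra (cone δ) := by
    intro k hk n hn
    refine hcone (e + k) n (by omega) (hdegree k n hn).2 fun i => ?_
    refine (monomial_le_degreeOf _ hn).trans ?_
    fin_cases i
    exacts [deg0 k hk, deg1 k hk, deg2 k hk]
  have hX3 : (X 3 : MvPolynomial (Fin 4) ℝ) ∈ supportAlgebra (cone δ) := by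
    intro n hn
    rw [support_X, Finset.mem_singleton] at hn
    subst hn
    intro j
    refine (Finset.sum_eq_zero fun l _ => ?_).ge
    have hl : (3 : Fin 4) ≠ l.castSucc := (Fin.castSucc_lt_last l).ne'
    rw [Finsupp.single_apply, if_neg hl, Nat.cast_zero, mul_zero]
  refine ⟨p, ?_, ?_⟩
  · rw [hpq, expShift_eq_sum]
    refine Subalgebra.sum_mem _ fun a ha => ?_
    rw [algebraMap_rat_eq_C, ← MvPolynomial.algebraMap_eq]
    exact Subalgebra.mul_mem _ (Subalgebra.mul_mem _
      (Subalgebra.pow_mem _ (Subalgebra.neg_mem _ hX3) _) (Subalgebra.algebraMap_mem _ _))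
      (hqcone _ (snd_le_of_mem_antidiagonal ha))
  · have hq0 : q 0 ≠ 0 := by
      intro h0
      rw [hq, expShift_zero_right] at h0
      have h1 := congrArg (aeval (![1, 0, Polynomial.X, 0] : Fin 4 → Polynomial ℝ)) h0
      rw [hh, map_binaryForm, map_zero, hS, hT, map_sub, map_sub, aeval_X, aeval_X, aeval_X] at h1
      simp only [Matrix.cons_val, sub_zero, binaryForm] at h1
      rw [Polynomial.aeval_homogenize_X_one _ (hηd 0 (Nat.zero_le _))] at h1
      exact hη0 h1
    obtain ⟨n, hn⟩ := support_nonempty.2 hq0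
    obtain ⟨h3, hdeg⟩ := hdegree 0 n hn
    refine ⟨n + Finsupp.single 3 K, ?_, by simp [h3], by simpa using hdeg⟩
    rw [mem_support_iff, hpq, expShift_eq_sum, coeff_sum]
    have hterm : ∀ a : ℕ × ℕ, (-X 3 : MvPolynomial (Fin 4) ℝ) ^ a.1 *
        algebraMap ℚ (MvPolynomial (Fin 4) ℝ) (1 / a.1.factorial) * q a.2 =
        monomial (Finsupp.single 3 a.1) ((-1) ^ a.1 * (1 / (a.1.factorial : ℝ))) * q a.2 := by
      intro a
      have hr : algebraMap ℚ ℝ (1 / (a.1.factorial : ℚ)) = 1 / (a.1.factorial : ℝ) := by simp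
      rw [algebraMap_rat_eq_C, hr, ← C_mul_X_pow_eq_monomial, C_mul, C_pow, C_neg, C_1, neg_pow]
      ring
    simp only [hterm, coeff_monomial_mul']
    rw [Finset.sum_eq_single (K, 0)]
    · rw [if_pos (by simp), add_tsub_cancel_right]
      refine mul_ne_zero (mul_ne_zero (pow_ne_zero _ (by norm_num)) ?_) (mem_support_iff.1 hn)
      positivity
    · intro a ha hne
      have hlt : a.1 < K := by
        have := Finset.HasAntidiagonal.mem_antidiagonal.1 ha
        rcases Nat.lt_or_ge a.1 K with h | h
        · exact h
        · exact absurd (Prod.ext (by simp; omega) (by simp; omega)) hne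
      rw [if_pos (by simp; omega)]
      refine mul_eq_zero_of_right _ (notMem_support_iff.1 fun hmem => ?_)
      have := (hdegree _ _ hmem).1
      simp [h3] at this
      omega
    · exact fun h => absurd (by simp) h

/-! ### Codegrees -/

/-- The fractions `θ i` of the numerical condition. In degree `d`, an exponent of the `i`-th
variable of size at most `(1 - θ i) * d` satisfies the `i`-th condition of the cone. -/
theorem exists_fractions_sum_lt_one {δ : Fin 3 → Fin 4 → ℕ} (hδ : ∀ i j : Fin 3, 1 ≤ δ i j.castSucc)
    (hcond :
      (δ 0 0 : ℝ) / ((δ 0 0 : ℝ) + min (δ 1 0 : ℝ) (δ 2 0 : ℝ))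
        + (δ 1 1 : ℝ) / ((δ 1 1 : ℝ) + min (δ 0 1 : ℝ) (δ 2 1 : ℝ))
        + (δ 2 2 : ℝ) / ((δ 2 2 : ℝ) + min (δ 0 2 : ℝ) (δ 1 2 : ℝ)) < 1) :
    ∃ θ : Fin 3 → ℝ, θ 0 + θ 1 + θ 2 < 1 ∧ ∀ i, 0 < θ i ∧ ∀ j, i ≠ j →
      (δ i i.castSucc : ℝ) * (1 - θ i) ≤ θ i * δ j i.castSucc := by
  have hpos : ∀ i j : Fin 3, (0 : ℝ) < δ i j.castSucc := fun i j => by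
    exact_mod_cast hδ i j
  have aux : ∀ {A m d : ℝ}, 0 < A → 0 < m → m ≤ d →
      A * (1 - A / (A + m)) ≤ A / (A + m) * d := by
    intro A m d hA hm hmd
    have h : A * (1 - A / (A + m)) = A / (A + m) * m := by
      field_simp
      ring
    rw [h]
    gcongr
  refine ⟨![(δ 0 0 : ℝ) / ((δ 0 0 : ℝ) + min (δ 1 0 : ℝ) (δ 2 0 : ℝ)),
    (δ 1 1 : ℝ) / ((δ 1 1 : ℝ) + min (δ 0 1 : ℝ) (δ 2 1 : ℝ)),
    (δ 2 2 : ℝ) / ((δ 2 2 : ℝ) + min (δ 0 2 : ℝ) (δ 1 2 : ℝ))], hcond, ?_⟩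
  have p0 : 0 < min (δ 1 0 : ℝ) (δ 2 0 : ℝ) := lt_min (hpos 1 0) (hpos 2 0)
  have p1 : 0 < min (δ 0 1 : ℝ) (δ 2 1 : ℝ) := lt_min (hpos 0 1) (hpos 2 1)
  have p2 : 0 < min (δ 0 2 : ℝ) (δ 1 2 : ℝ) := lt_min (hpos 0 2) (hpos 1 2)
  have d0 := hpos 0 0
  have d1 := hpos 1 1
  have d2 := hpos 2 2
  intro i
  fin_cases i
  · refine ⟨div_pos d0 (add_pos d0 p0), fun j hj => aux d0 p0 ?_⟩
    fin_cases j
    exacts [absurd rfl hj, min_le_left _ _, min_le_right _ _]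
  · refine ⟨div_pos d1 (add_pos d1 p1), fun j hj => aux d1 p1 ?_⟩
    fin_cases j
    exacts [min_le_left _ _, absurd rfl hj, min_le_right _ _]
  · refine ⟨div_pos d2 (add_pos d2 p2), fun j hj => aux d2 p2 ?_⟩
    fin_cases j
    exacts [min_le_left _ _, min_le_right _ _, absurd rfl hj]

/-- The codegrees `⌈θ i * d⌉` satisfy the assumptions of `exists_invariant`: as the sum of the
`θ i` is less than one, there is room for the rounding errors when `d` is large. -/
theorem exists_codegrees {δ : Fin 3 → Fin 4 → ℕ} {θ : Fin 3 → ℝ} (hsum : θ 0 + θ 1 + θ 2 < 1)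
    (hθ : ∀ i, 0 < θ i ∧ ∀ j, i ≠ j →
      (δ i i.castSucc : ℝ) * (1 - θ i) ≤ θ i * δ j i.castSucc) :
    ∃ (c : Fin 3 → ℕ → ℕ) (e : ℕ), (∀ i d, c i (d + 1) ≤ c i d + 1) ∧
      (∀ d, e ≤ d → c 0 d + c 1 d + c 2 d ≤ d) ∧
      ∀ (d : ℕ) (n : Fin 4 →₀ ℕ), e ≤ d → n 0 + n 1 + n 2 = d →
        (∀ i : Fin 3, n i.castSucc ≤ d - c i d) → n ∈ cone δ := by
  have hle : ∀ i, θ i ≤ 1 := by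
    have h0 := (hθ 0).1
    have h1 := (hθ 1).1
    have h2 := (hθ 2).1
    intro i
    fin_cases i <;> simp only [Fin.zero_eta, Fin.mk_one, Fin.reduceFinMk] <;> linarith
  have hroom : ∀ d : ℕ, ⌈3 / (1 - (θ 0 + θ 1 + θ 2))⌉₊ ≤ d →
      ⌈θ 0 * d⌉₊ + ⌈θ 1 * d⌉₊ + ⌈θ 2 * d⌉₊ ≤ d := by
    intro d hd
    have h1 : 3 ≤ d * (1 - (θ 0 + θ 1 + θ 2)) :=
      (div_le_iff₀ (by linarith)).1 (Nat.ceil_le.1 hd)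
    have hc : ∀ i, (⌈θ i * d⌉₊ : ℝ) < θ i * d + 1 := fun i =>
      Nat.ceil_lt_add_one (mul_nonneg (hθ i).1.le (Nat.cast_nonneg d))
    have c0 := hc 0
    have c1 := hc 1
    have c2 := hc 2
    have : ((⌈θ 0 * d⌉₊ + ⌈θ 1 * d⌉₊ + ⌈θ 2 * d⌉₊ : ℕ) : ℝ) ≤ d := by
      push_cast
      linarith
    exact_mod_cast this
  refine ⟨fun i d => ⌈θ i * d⌉₊, ⌈3 / (1 - (θ 0 + θ 1 + θ 2))⌉₊, fun i d => ?_, hroom, ?_⟩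
  · rw [Nat.ceil_le]
    push_cast
    have := Nat.le_ceil (θ i * d)
    have := hle i
    linarith
  · intro d n hd hn h
    rw [mem_cone_iff]
    intro i j k hij hik hjk
    have hd' : n i.castSucc + n j.castSucc + n k.castSucc = d := by
      have h3 : n 0 + n 1 + n 2 = ∑ l : Fin 3, n l.castSucc := by
        rw [Fin.sum_univ_three]
        rfl
      rw [h3, univ_eq_of_ne hij hik hjk, Finset.sum_insert (by simp [hij, hik]),
        Finset.sum_pair hjk] at hn
      omega
    have hci : ⌈θ i * d⌉₊ ≤ d := by
      rw [Nat.ceil_le]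
      exact mul_le_of_le_one_left (Nat.cast_nonneg d) (hle i)
    have h1 : n i.castSucc + ⌈θ i * d⌉₊ ≤ d := by
      have : n i.castSucc ≤ d - ⌈θ i * d⌉₊ := h i
      omega
    have h2 : (n i.castSucc : ℝ) + θ i * d ≤ d := by
      have h1' : ((n i.castSucc + ⌈θ i * d⌉₊ : ℕ) : ℝ) ≤ d := by exact_mod_cast h1
      push_cast at h1'
      have := Nat.le_ceil (θ i * d)
      linarith
    have hdr : (n i.castSucc : ℝ) + n j.castSucc + n k.castSucc = d := by exact_mod_cast hd'
    obtain ⟨hpos, hδ⟩ := hθ i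
    have hj := mul_le_mul_of_nonneg_right (hδ j hij) (Nat.cast_nonneg (α := ℝ) (n j.castSucc))
    have hk := mul_le_mul_of_nonneg_right (hδ k hik) (Nat.cast_nonneg (α := ℝ) (n k.castSucc))
    have hi : θ i * n i.castSucc ≤ (1 - θ i) * (n j.castSucc + n k.castSucc) := by
      rw [← hdr] at h2
      linarith
    have hi' := mul_le_mul_of_nonneg_left hi (Nat.cast_nonneg (α := ℝ) (δ i i.castSucc))
    have : (δ i i.castSucc * n i.castSucc : ℝ) ≤
        δ j i.castSucc * n j.castSucc + δ k i.castSucc * n k.castSucc := by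
      refine le_of_mul_le_mul_left ?_ hpos
      linarith
    exact_mod_cast this

/-! ### The algebra is not finitely generated -/

theorem sum_pderiv_diagHom (p : MvPolynomial (Fin 3) ℝ) :
    ∑ l : Fin 4, pderiv l (diagHom p) = 0 := by
  induction p using MvPolynomial.induction_on with
  | C r =>
    rw [← MvPolynomial.algebraMap_eq, AlgHom.commutes, MvPolynomial.algebraMap_eq]
    simp
  | add p q hp hq => simp only [map_add, Finset.sum_add_distrib, hp, hq, add_zero]
  | mul_X p i hp =>
    have hX : ∑ l : Fin 4, pderiv l (diagHom (X i)) = 0 := by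
      rw [diagHom, aeval_X]
      simp [pderiv_X, Pi.single_apply]
    simp only [map_mul, pderiv_mul, Finset.sum_add_distrib, ← Finset.sum_mul, ← Finset.mul_sum, hp,
      hX, zero_mul, mul_zero, add_zero]

/-- An invariant polynomial with support in the cone has no terms `c * y₄ ^ m` with `m > 0`: its
derivative along the diagonal would contain `y₄ ^ (m - 1)`, since the monomials `y_i * y₄ ^ (m - 1)`
do not belong to the cone. -/
theorem coeff_single_three_eq_zero {δ : Fin 3 → Fin 4 → ℕ} (hδ : Admissible δ)
    {p : MvPolynomial (Fin 3) ℝ} (hp : diagHom p ∈ supportAlgebra (cone δ)) (m : ℕ) :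
    coeff (Finsupp.single 3 (m + 1)) (diagHom p) = 0 := by
  have h := congrArg (coeff (Finsupp.single 3 m)) (sum_pderiv_diagHom p)
  rw [coeff_sum, coeff_zero, Fin.sum_univ_castSucc, Finset.sum_eq_zero, zero_add] at h
  · rw [coeff_pderiv, show Fin.last 3 = 3 from rfl, ← Finsupp.single_add,
      Finsupp.single_eq_same] at h
    exact (mul_eq_zero.1 h).resolve_right (by positivity)
  · intro i _
    rw [coeff_pderiv, mul_eq_zero]
    left
    by_contra hne
    have hw := hp _ (mem_support_iff.2 hne) i
    have hsingle : ∀ l : Fin 3, (Finsupp.single (3 : Fin 4) m + Finsupp.single i.castSucc 1 :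
        Fin 4 →₀ ℕ) l.castSucc = if l = i then 1 else 0 := by
      intro l
      have hl : (3 : Fin 4) ≠ l.castSucc := (Fin.castSucc_lt_last l).ne'
      rw [Finsupp.add_apply, Finsupp.single_apply, if_neg hl, zero_add, Finsupp.single_apply]
      simp only [Fin.castSucc_inj, eq_comm]
    rw [weight] at hw
    simp only [hsingle, Nat.cast_ite, Nat.cast_one, Nat.cast_zero, mul_ite, mul_one, mul_zero,
      Finset.sum_ite_eq', Finset.mem_univ, if_true, expVec_diag] at hw
    have := hδ.pos i i
    omega

/-- The exponents whose last entry is at most `N` times the sum of the others. -/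
def slopeCone (N : ℕ) : AddSubmonoid (Fin 4 →₀ ℕ) where
  carrier := {n | n 3 ≤ N * (n 0 + n 1 + n 2)}
  zero_mem' := by simp
  add_mem' := fun {a b} ha hb => by
    simp only [Set.mem_ofPred_eq, Finsupp.add_apply] at *
    linarith

theorem mem_slopeCone {N : ℕ} {n : Fin 4 →₀ ℕ} :
    n ∈ slopeCone N ↔ n 3 ≤ N * (n 0 + n 1 + n 2) := Iff.rfl

theorem exists_mem_supportAlgebra_slopeCone {δ : Fin 3 → Fin 4 → ℕ} (hδ : Admissible δ)
    {p : MvPolynomial (Fin 3) ℝ} (hp : diagHom p ∈ supportAlgebra (cone δ)) :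
    ∃ N, ∀ M, N ≤ M → diagHom p ∈ supportAlgebra (slopeCone M) := by
  refine ⟨(diagHom p).degreeOf 3, fun M hM n hn => ?_⟩
  rw [mem_slopeCone]
  have h3 := (monomial_le_degreeOf 3 hn).trans hM
  rcases Nat.eq_zero_or_pos (n 0 + n 1 + n 2) with h0 | h0
  · rcases Nat.eq_zero_or_pos (n 3) with h | h
    · omega
    obtain ⟨m, hm⟩ := Nat.exists_eq_succ_of_ne_zero h.ne'
    have hn' : n = Finsupp.single 3 (m + 1) := by
      ext l
      fin_cases l <;> simp [hm] <;> omega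
    rw [hn'] at hn
    exact absurd (coeff_single_three_eq_zero hδ hp m) (mem_support_iff.1 hn)
  · nlinarith

theorem not_fg_comap_supportAlgebra_cone {δ : Fin 3 → Fin 4 → ℕ} (hδ : Admissible δ)
    {c : Fin 3 → ℕ → ℕ} {e : ℕ} (hstep : ∀ i d, c i (d + 1) ≤ c i d + 1)
    (hsum : ∀ d, e ≤ d → c 0 d + c 1 d + c 2 d ≤ d)
    (hcone : ∀ (d : ℕ) (n : Fin 4 →₀ ℕ), e ≤ d → n 0 + n 1 + n 2 = d →
      (∀ i : Fin 3, n i.castSucc ≤ d - c i d) → n ∈ cone δ) :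
    ¬ ((supportAlgebra (cone δ)).comap diagHom).FG := by
  rintro ⟨s, hs⟩
  have hgen : ∀ p ∈ s, diagHom p ∈ supportAlgebra (cone δ) := fun p hp => by
    have : p ∈ (supportAlgebra (cone δ)).comap diagHom := hs ▸ Algebra.subset_adjoin hp
    exact this
  have hN : ∀ p : MvPolynomial (Fin 3) ℝ, ∃ N, p ∈ s → ∀ M, N ≤ M →
      diagHom p ∈ supportAlgebra (slopeCone M) := by
    intro p
    by_cases hp : p ∈ s
    · obtain ⟨N, h⟩ := exists_mem_supportAlgebra_slopeCone hδ (hgen p hp)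
      exact ⟨N, fun _ => h⟩
    · exact ⟨0, fun h => absurd h hp⟩
  choose N hN using hN
  have hle : (supportAlgebra (cone δ)).comap diagHom ≤
      (supportAlgebra (slopeCone (s.sup N))).comap diagHom := by
    rw [← hs, Algebra.adjoin_le_iff]
    exact fun p hp => hN p hp _ (Finset.le_sup hp)
  obtain ⟨p, hp, n, hn, h3, hne⟩ := exists_invariant hstep hsum hcone (s.sup N * e + 1)
  have := mem_slopeCone.1 (hle hp n hn)
  rw [h3, hne] at this
  omega

end Invariants

end Kuroda

theorem lemma3 (δ : Fin 3 → Fin 4 → ℕ) (γ : ℕ)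
    (hδ : ∀ i j : Fin 3, 1 ≤ δ i j.castSucc) (hγ : 0 < γ)
    (hcond :
      (δ 0 0 : ℝ) / ((δ 0 0 : ℝ) + min (δ 1 0 : ℝ) (δ 2 0 : ℝ))
        + (δ 1 1 : ℝ) / ((δ 1 1 : ℝ) + min (δ 0 1 : ℝ) (δ 2 1 : ℝ))
        + (δ 2 2 : ℝ) / ((δ 2 2 : ℝ) + min (δ 0 2 : ℝ) (δ 1 2 : ℝ)) < 1) :
    -- `ℝ[y]` and `ℝ[Π]` are polynomial rings, the coordinate rings of `ℝ⁴` and `ℝ³`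
    AlgebraicIndependent ℝ (Kuroda.y δ γ) ∧
    AlgebraicIndependent ℝ (Kuroda.bigPi δ γ) ∧
    -- `T` is generated by `M`
    Kuroda.algT δ γ = Algebra.adjoin ℝ (Kuroda.monomialsM δ γ) ∧
    -- `S'` is open semialgebraic, and its bounded polynomials are `T`, as subalgebras of `ℝ[y]`
    IsOpen (Kuroda.starSet δ) ∧
    Kuroda.IsSemialgebraic (Kuroda.starSet δ) ∧
    (∀ r : ℝ, 0 < r →
      (Kuroda.boundedPolynomials (r • Kuroda.starSet δ)).map
        (MvPolynomial.aeval (Kuroda.y δ γ)) = Kuroda.algT δ γ) ∧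
    -- `S` is open semialgebraic, and its bounded polynomials are `R`, as subalgebras of `ℝ[Π]`
    IsOpen (Kuroda.projStar δ) ∧
    Kuroda.IsSemialgebraic (Kuroda.projStar δ) ∧
    (∀ r : ℝ, 0 < r →
      (Kuroda.boundedPolynomials (r • Kuroda.projStar δ)).map
        (MvPolynomial.aeval (Kuroda.bigPi δ γ)) = Kuroda.algR δ γ) ∧
    ¬ (Kuroda.boundedPolynomials (Kuroda.projStar δ)).FG := by
  have hadm := Kuroda.Admissible.of_sum_lt_one hδ hcond
  refine ⟨Kuroda.algebraicIndependent_y hadm hγ, Kuroda.algebraicIndependent_bigPi hadm hγ,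
    Kuroda.algT_eq_adjoin hadm hγ, Kuroda.isOpen_starSet δ, Kuroda.isSemialgebraic_starSet δ,
    fun r hr => ?_, Kuroda.isOpen_projStar δ, Kuroda.isSemialgebraic_projStar δ,
    fun r hr => ?_, ?_⟩
  · rw [Kuroda.boundedPolynomials_starSet hadm hr, Kuroda.map_supportAlgebra_cone hadm hγ]
  · rw [Kuroda.boundedPolynomials_projStar hadm hr, Kuroda.map_comap_supportAlgebra_cone hadm hγ]
  · obtain ⟨θ, hsum, hθ⟩ := Kuroda.exists_fractions_sum_lt_one hδ hcond
    obtain ⟨c, e, h1, h2, h3⟩ := Kuroda.exists_codegrees hsum hθ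
    have := Kuroda.boundedPolynomials_projStar hadm one_pos
    rw [one_smul] at this
    rw [this]
    exact Kuroda.not_fg_comap_supportAlgebra_cone hadm h1 h2 h3
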